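/- Let $\mathbb{D}$ be the open unit disc and let $H^2(\mathbb{D}^2)$ be the Hilbert space of holomorphic functions $F(z,w)=\sum_{j,k\ge 0}a_{jk}z^jw^k$ on $\mathbb{D}^2$ with $\sum_{j,k}|a_{jk}|^2<\infty$, with the inner product $\langle F,G\rangle=\sum_{j,k}a_{jk}\overline{b_{jk}}$ (where $G=\sum b_{jk}z^jw^k$). Let $M_z,M_w$ be multiplication by the coordinate functions. A submodule is a closed subspace $\mathcal{S}\subseteq H^2(\mathbb{D}^2)$ with $M_z\mathcal{S}\subseteq\mathcal{S}$ and $M_w\mathcal{S}\subseteq\mathcal{S}$. It is called co-doubly commuting if, for $\mathcal{Q}=\mathcal{S}^{\perp}$, $C_z=P_{\mathcal{Q}}M_z|_{\mathcal{Q}}$ and $C_w=P_{\mathcal{Q}}M_w|_{\mathcal{Q}}$, one has $C_zC_w^*=C_w^*C_z$. The rank of $\mathcal{S}$ is the least cardinality of a set $E\subseteq\mathcal{S}$ such that $\mathcal{S}$ is the closed linear span of $\{M_z^kM_w^lf : f\in E,\ k,l\ge 0\}$. An inner function on $\mathbb{D}$ is a bounded holomorphic function $\varphi(z)=\sum_{n\ge0}a_nz^n$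 whose boundary function (the element of $L^2(\mathbb{T})$ with Fourier series $\sum_{n\ge 0}a_ne^{int}$) has modulus $1$ almost everywhere on the unit circle $\mathbb{T}$. **Corollary.** Let $\mathcal{S}$ be a co-doubly commuting submodule of $H^2(\mathbb{D}^2)$. Then $\operatorname{rank}\mathcal{S}=1$ if and only if $\mathcal{S}=\Theta H^2(\mathbb{D}^2)$ for some one-variable inner function $\Theta$, that is, for some $\Theta$ of the form $\Theta(z,w)=\varphi(z)$ or $\Theta(z,w)=\varphi(w)$ with $\varphi$ an inner function on $\mathbb{D}$. -/

import Mathlib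

open MeasureTheory AddCircle
open scoped ENNReal

noncomputable section

namespace HardyBidisc

/-! ### Rank of a tuple of operators -/

section Rank

variable {H : Type*} [NormedAddCommGroup H] [NormedSpace ℂ H] {n : ℕ}

/-- `[E]_T`: the closed linear span of all `T₁^{k₁} ⋯ Tₙ^{kₙ} e`, with `e ∈ E` and `kⱼ ≥ 0`. -/
def generatedSubspace (T : Fin n → H →L[ℂ] H) (E : Set H) : Submodule ℂ H :=
  (Submodule.span ℂ
    {x : H | ∃ k : Fin n → ℕ, ∃ e ∈ E, x = (List.ofFn fun i => T i ^ k i).prod e}).topologicalClosure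

/-- The rank of a tuple of operators: the least cardinality of a set `E` with `[E]_T = H`. -/
def tupleRank (T : Fin n → H →L[ℂ] H) : Cardinal :=
  sInf {c : Cardinal | ∃ E : Set H, generatedSubspace T E = ⊤ ∧ c = Cardinal.mk E}

end Rank

/-! ### The Hardy space over the bidisc -/

/-- `H²(𝔻²)`, a function `F(z,w) = ∑ a_{jk} z^j w^k` being given by its square summable family of
Taylor coefficients `a`; the inner product is the one of `ℓ²(ℕ × ℕ)`.
`eval` gives back the function, and `eval_injective` says that it determines the element. -/
abbrev H2 : Type := lp (fun _ : ℕ × ℕ => ℂ) 2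

/-- The value `F(z,w) = ∑ a_{jk} z^j w^k`, for `|z| < 1` and `|w| < 1`. -/
def eval (F : H2) (z w : ℂ) : ℂ := ∑' p : ℕ × ℕ, F p * (z ^ p.1 * w ^ p.2)

theorem hasSum_eval (F : H2) {z w : ℂ} (hz : ‖z‖ < 1) (hw : ‖w‖ < 1) :
    HasSum (fun p : ℕ × ℕ => F p * (z ^ p.1 * w ^ p.2)) (eval F z w) := by
  have hg : Summable fun p : ℕ × ℕ => ‖z‖ ^ p.1 * ‖w‖ ^ p.2 :=
    (summable_geometric_of_lt_one (norm_nonneg z) hz).mul_of_nonneg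
      (summable_geometric_of_lt_one (norm_nonneg w) hw)
      (fun _ => by positivity) (fun _ => by positivity)
  refine Summable.hasSum (Summable.of_norm_bounded (hg.mul_left ‖F‖) fun p => ?_)
  rw [norm_mul, norm_mul, norm_pow, norm_pow]
  exact mul_le_mul_of_nonneg_right (lp.norm_apply_le_norm (by norm_num) F p) (by positivity)

theorem coeff_eq_zero {a : ℕ → ℂ} (h : ∀ z : ℂ, ‖z‖ < 1 → HasSum (fun n => a n * z ^ n) 0)
    (n : ℕ) : a n = 0 := by
  have h1 : HasFPowerSeriesAt (fun _ : ℂ => (0 : ℂ)) (FormalMultilinearSeries.ofScalars ℂ a) 0 := by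
    rw [hasFPowerSeriesAt_iff]
    filter_upwards [Metric.ball_mem_nhds (0 : ℂ) one_pos] with z hz
    have := h z (by simpa using hz)
    simpa [FormalMultilinearSeries.coeff_ofScalars, mul_comm] using this
  have h2 := h1.eq_zero
  have h3 := FormalMultilinearSeries.coeff_ofScalars (𝕜 := ℂ) (p := a) (n := n)
  rw [← h3, h2]
  simp [FormalMultilinearSeries.coeff]

/-- An element of `H²(𝔻²)` is determined by its values on the bidisc. -/
theorem eval_injective {F G : H2}
    (h : ∀ z w : ℂ, ‖z‖ < 1 → ‖w‖ < 1 → eval F z w = eval G z w) : F = G := by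
  have key : ∀ j k, F (j, k) - G (j, k) = 0 := by
    have h0 : ∀ z w : ℂ, ‖z‖ < 1 → ‖w‖ < 1 →
        HasSum (fun p : ℕ × ℕ => (F p - G p) * (z ^ p.1 * w ^ p.2)) 0 := by
      intro z w hz hw
      have := (hasSum_eval F hz hw).sub (hasSum_eval G hz hw)
      rw [h z w hz hw, sub_self] at this
      simpa only [sub_mul] using this
    have hrow : ∀ (w : ℂ), ‖w‖ < 1 → ∀ j, Summable fun k => (F (j, k) - G (j, k)) * w ^ k := by
      intro w hw j
      refine Summable.of_norm_bounded
        ((summable_geometric_of_lt_one (norm_nonneg w) hw).mul_left ‖F - G‖) fun k => ?_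
      rw [norm_mul, norm_pow]
      exact mul_le_mul_of_nonneg_right (lp.norm_apply_le_norm (by norm_num) (F - G) (j, k))
        (by positivity)
    intro j k
    refine coeff_eq_zero (a := fun k => F (j, k) - G (j, k)) (fun w hw => ?_) k
    have h4 : ∑' k, (F (j, k) - G (j, k)) * w ^ k = 0 := by
      refine coeff_eq_zero (a := fun j => ∑' k, (F (j, k) - G (j, k)) * w ^ k) (fun z hz => ?_) j
      refine (h0 z w hz hw).prod_fiberwise fun j => ?_
      have := (hrow w hw j).hasSum.mul_right (z ^ j)
      simpa only [mul_assoc, mul_comm (z ^ j)] using this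
    rw [← h4]
    exact (hrow w hw j).hasSum
  ext p
  exact sub_eq_zero.1 (key p.1 p.2)

theorem support_extend_subset (e : ℕ × ℕ → ℕ × ℕ) (a : ℕ × ℕ → ℂ) :
    Function.support (fun p => ‖Function.extend e a 0 p‖ ^ (2 : ℝ≥0∞).toReal) ⊆ Set.range e := by
  intro p hp
  by_contra hne
  exact hp (by simp [Function.extend_apply' _ _ _ hne])

theorem memℓp_extend (e : ℕ × ℕ → ℕ × ℕ) (he : Function.Injective e) (F : H2) :
    Memℓp (E := fun _ : ℕ × ℕ => ℂ) (Function.extend e (⇑F) 0) 2 := by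
  refine memℓp_gen ?_
  rw [← he.summable_iff fun p hp =>
    Function.notMem_support.1 fun h => hp (support_extend_subset e F h)]
  simpa [Function.comp_def, he.extend_apply] using (lp.memℓp F).summable (by norm_num)

/-- The shift of coefficients along an injective map of `ℕ × ℕ` into itself: the coefficient of
`e p` in the image is the coefficient of `p` in `F`, all others vanish. -/
def shift (e : ℕ × ℕ → ℕ × ℕ) (he : Function.Injective e) : H2 →ₗᵢ[ℂ] H2 where
  toFun F := ⟨Function.extend e (⇑F) 0, memℓp_extend e he F⟩
  map_add' F G := by
    ext p
    change Function.extend e (⇑F + ⇑G) 0 p = Function.extend e (⇑F) 0 p + Function.extend e (⇑G) 0 p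
    by_cases hp : ∃ q, e q = p
    · obtain ⟨q, rfl⟩ := hp
      simp [he.extend_apply]
    · simp [Function.extend_apply' _ _ _ hp]
  map_smul' c F := by
    ext p
    change Function.extend e (c • ⇑F) 0 p = c • Function.extend e (⇑F) 0 p
    by_cases hp : ∃ q, e q = p
    · obtain ⟨q, rfl⟩ := hp
      simp [he.extend_apply]
    · simp [Function.extend_apply' _ _ _ hp]
  norm_map' F := by
    rw [lp.norm_eq_tsum_rpow (by norm_num), lp.norm_eq_tsum_rpow (by norm_num)]
    congr 1
    refine (he.tsum_eq (support_extend_subset e F)).symm.trans ?_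
    simp [he.extend_apply]

theorem shift_apply (e : ℕ × ℕ → ℕ × ℕ) (he : Function.Injective e) (F : H2) (p : ℕ × ℕ) :
    shift e he F (e p) = F p :=
  he.extend_apply _ _ _

theorem shift_apply_of_notMem (e : ℕ × ℕ → ℕ × ℕ) (he : Function.Injective e) (F : H2)
    (p : ℕ × ℕ) (hp : p ∉ Set.range e) : shift e he F p = 0 :=
  Function.extend_apply' _ _ _ hp

theorem injective_succ_fst : Function.Injective fun p : ℕ × ℕ => (p.1 + 1, p.2) :=
  fun p q h => by simpa [Prod.ext_iff] using h

theorem injective_succ_snd : Function.Injective fun p : ℕ × ℕ => (p.1, p.2 + 1) :=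
  fun p q h => by simpa [Prod.ext_iff] using h

/-- `M_z`, the multiplication by the first coordinate function. -/
def Mz : H2 →L[ℂ] H2 := (shift _ injective_succ_fst).toContinuousLinearMap

/-- `M_w`, the multiplication by the second coordinate function. -/
def Mw : H2 →L[ℂ] H2 := (shift _ injective_succ_snd).toContinuousLinearMap

theorem eval_shift (e : ℕ × ℕ → ℕ × ℕ) (he : Function.Injective e) (F : H2) (z w c : ℂ)
    (hc : ∀ p : ℕ × ℕ, z ^ (e p).1 * w ^ (e p).2 = c * (z ^ p.1 * w ^ p.2)) :
    eval (shift e he F) z w = c * eval F z w := by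
  unfold eval
  rw [← he.tsum_eq, ← tsum_mul_left]
  · refine tsum_congr fun p => ?_
    rw [shift_apply, hc]
    ring
  · intro p hp
    by_contra hne
    exact hp (by simp [shift_apply_of_notMem e he F p hne])

theorem eval_Mz (F : H2) (z w : ℂ) : eval (Mz F) z w = z * eval F z w :=
  eval_shift _ injective_succ_fst F z w z fun p => by ring

theorem eval_Mw (F : H2) (z w : ℂ) : eval (Mw F) z w = w * eval F z w :=
  eval_shift _ injective_succ_snd F z w w fun p => by ring

/-! ### Submodules, quotient modules, rank -/

/-- A submodule of `H²(𝔻²)`: a closed subspace invariant under `M_z` and `M_w`. -/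
structure IsHardySubmodule (S : Submodule ℂ H2) : Prop where
  isClosed : IsClosed (S : Set H2)
  mz_mem : ∀ F ∈ S, Mz F ∈ S
  mw_mem : ∀ F ∈ S, Mw F ∈ S

/-- The rank of a submodule `S`: the rank of the pair `(M_z|_S, M_w|_S)`. -/
def IsHardySubmodule.rank {S : Submodule ℂ H2} (hS : IsHardySubmodule S) : Cardinal :=
  tupleRank ![(Mz ∘L S.subtypeL).codRestrict S fun F => hS.mz_mem F F.2,
    (Mw ∘L S.subtypeL).codRestrict S fun F => hS.mw_mem F F.2]

/-- The compression `P_Q A|_Q` of an operator `A` to a closed subspace `Q`. -/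
def compression (Q : Submodule ℂ H2) [CompleteSpace Q] (A : H2 →L[ℂ] H2) : Q →L[ℂ] Q :=
  Q.orthogonalProjectionOnto ∘L A ∘L Q.subtypeL

/-- `C_z C_w^* = C_w^* C_z`, with `C_z = P_Q M_z|_Q` and `C_w = P_Q M_w|_Q`. -/
def IsDoublyCommuting (Q : Submodule ℂ H2) [CompleteSpace Q] : Prop :=
  compression Q Mz ∘L (compression Q Mw).adjoint =
    (compression Q Mw).adjoint ∘L compression Q Mz

/-- `S` is a co-doubly commuting submodule: a submodule whose quotient module `Sᗮ` is doubly
commuting. -/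
structure IsCoDoublyCommuting (S : Submodule ℂ H2) : Prop extends IsHardySubmodule S where
  doublyCommuting : IsDoublyCommuting Sᗮ

/-! ### Inner functions -/

/-- `g ∈ L²(𝕋)` is the boundary function of the holomorphic function `φ(z) = ∑ aₙ zⁿ` on `𝔻`:
its Fourier series is `∑_{n ≥ 0} aₙ ζⁿ`, `ζ = e^{2πit}`. The circle, parametrized by
`t ∈ ℝ/ℤ`, carries the normalized Lebesgue measure. -/
structure IsBoundaryFunction (φ : ℂ → ℂ) (g : Lp ℂ 2 (haarAddCircle (T := 1))) :
    Prop where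
  fourierCoeff_neg : ∀ n : ℤ, n < 0 → fourierCoeff g n = 0
  hasSum : ∀ z : ℂ, ‖z‖ < 1 → HasSum (fun n : ℕ => fourierCoeff g (n : ℤ) * z ^ n) (φ z)

/-- Inner functions on `𝔻`: bounded, holomorphic, of modulus one almost everywhere on `𝕋`.
Only the values of `φ` on `𝔻` matter. -/
structure IsInner (φ : ℂ → ℂ) : Prop where
  holomorphic : DifferentiableOn ℂ φ (Metric.ball 0 1)
  bounded : ∃ C : ℝ, ∀ z : ℂ, ‖z‖ < 1 → ‖φ z‖ ≤ C
  unimodular : ∃ g : Lp ℂ 2 (haarAddCircle (T := 1)), IsBoundaryFunction φ g ∧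
    ∀ᵐ t ∂(haarAddCircle (T := 1)), ‖g t‖ = 1

/-- `Θ` is a one-variable inner function on the bidisc: an inner function of `z` alone or of `w`
alone. -/
def IsOneVariableInner (Θ : ℂ → ℂ → ℂ) : Prop :=
  ∃ φ : ℂ → ℂ, IsInner φ ∧
    ((∀ z w : ℂ, ‖z‖ < 1 → ‖w‖ < 1 → Θ z w = φ z) ∨
      (∀ z w : ℂ, ‖z‖ < 1 → ‖w‖ < 1 → Θ z w = φ w))

/-- `Θ H²(𝔻²)`, the set of all `F ∈ H²(𝔻²)` of the form `F = Θ G` with `G ∈ H²(𝔻²)`. -/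
def mulRange (Θ : ℂ → ℂ → ℂ) : Set H2 :=
  {F | ∃ G : H2, ∀ z w : ℂ, ‖z‖ < 1 → ‖w‖ < 1 → eval F z w = Θ z w * eval G z w}

end HardyBidisc

end

/-! Write Q = Sᗮ and κ = P_Q 1. On the whole bidisc (1 - M_z M_z*)(1 - M_w M_w*) is the projection
onto the constants. Double commutativity lets this identity descend to Q, so that (1 - C_z C_z*)(1 -
C_w C_w*) is the rank one operator x ↦ ⟨κ, x⟩κ (`compression_defect`). The two factors commute and
have κ as a common eigenvector, which makes the Gram matrix of the vectors C_z^j C_w^k κ = P_Q(z^j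
w^k) a product of a matrix in z and a matrix in w (`exists_gram_factorization`). Hence P_Q sends
monomials to elementary tensors, and Q is the Hilbert tensor product of the complements of the
slices of S, the functions of z alone and of w alone that lie in S.

By Beurling's theorem each slice is zero or of the form φ H²(𝔻). If both vanish then S = 0, of rank
zero; if exactly one vanishes then S = φ H²(𝔻²) with φ a function of one variable. Everything rests
on showing that S ≠ ⊤ with both slices nonzero, say φ₁H² and φ₂H², has no generator.

Let V and W be multiplication by φ₁(z) and φ₂(w). They are doubly commuting isometries, so every f ∈
S is Va + Wb (`exists_eq_add_of_doublyCommuting`). Let U be the conjugate linear Hankel operator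
with symbol z̄w̄φ₁(z)φ₂(w). It is symmetric, satisfies UV = UW = 0, and has kernel inside S. By
symmetry v = V(Ub) - W(Ua) ∈ S is orthogonal to all monomial multiples of f. If v = 0, then Ua = 0,
so a ∈ S, and then Vq is orthogonal to the same orbit for any nonzero q ∈ Q. Either way f does not
generate S (`exists_orthogonal_orbit`).

Inner functions enter as the φ for which the zⁿφ are orthonormal: this says that the squared modulus
of the boundary function has the Fourier coefficients of 1. The converse follows because
multiplication by such a φ is an isometry commuting with the shifts, so that the image of 1
generates its range. -/

noncomputable section

namespace HardyBidisc

open scoped InnerProductSpace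

/-! ### Square summable families -/

section Basis

variable {ι : Type*} [DecidableEq ι] {E : Type*} [NormedAddCommGroup E] [InnerProductSpace ℂ E]

/-- The standard orthonormal basis of `ℓ²(ι)`. -/
def unitVec (i : ι) : lp (fun _ : ι => ℂ) 2 := lp.single 2 i (1 : ℂ)

theorem inner_unitVec_left (i : ι) (x : lp (fun _ : ι => ℂ) 2) : ⟪unitVec i, x⟫_ℂ = x i := by
  rw [unitVec, lp.inner_single_left]
  simp

theorem unitVec_apply (i j : ι) : unitVec i j = if j = i then (1 : ℂ) else 0 := by
  rw [unitVec, lp.single_apply, Pi.single_apply]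

theorem orthonormal_unitVec : Orthonormal ℂ (unitVec : ι → lp (fun _ : ι => ℂ) 2) := by
  rw [orthonormal_iff_ite]
  intro i j
  rw [inner_unitVec_left, unitVec_apply]

theorem ext_inner_unitVec {x y : lp (fun _ : ι => ℂ) 2}
    (h : ∀ i, ⟪unitVec i, x⟫_ℂ = ⟪unitVec i, y⟫_ℂ) : x = y := by
  ext i
  simpa only [inner_unitVec_left] using h i

/-- A property that holds on the standard basis and is preserved by linear combinations and limits
holds everywhere. -/
theorem unitVec_induction {p : lp (fun _ : ι => ℂ) 2 → Prop} (x : lp (fun _ : ι => ℂ) 2)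
    (basis : ∀ i, p (unitVec i)) (zero : p 0) (add : ∀ x y, p x → p y → p (x + y))
    (smul : ∀ (c : ℂ) x, p x → p (c • x)) (closed : IsClosed {x | p x}) : p x := by
  have hs : HasSum (fun i => lp.single 2 i (x i)) x := lp.hasSum_single (by norm_num) x
  refine closed.mem_of_tendsto hs (Filter.Eventually.of_forall fun s => ?_)
  induction s using Finset.induction_on with
  | empty => simpa using zero
  | insert i s hi ih =>
    rw [Finset.sum_insert hi]
    refine add _ _ ?_ ih
    have : lp.single 2 i (x i) = x i • (unitVec i : lp (fun _ : ι => ℂ) 2) := by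
      rw [unitVec, ← lp.single_smul, smul_eq_mul, mul_one]
    rw [this]
    exact smul _ _ (basis i)

theorem mem_of_unitVec_mem {K : Submodule ℂ (lp (fun _ : ι => ℂ) 2)}
    (hK : IsClosed (K : Set (lp (fun _ : ι => ℂ) 2))) (h : ∀ i, unitVec i ∈ K)
    (x : lp (fun _ : ι => ℂ) 2) : x ∈ K :=
  unitVec_induction x h K.zero_mem (fun _ _ => K.add_mem) (fun c _ => K.smul_mem c) hK

theorem clm_ext_unitVec {F : Type*} [NormedAddCommGroup F] [NormedSpace ℂ F]
    {A B : lp (fun _ : ι => ℂ) 2 →L[ℂ] F}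
    (h : ∀ i, A (unitVec i) = B (unitVec i)) (x : lp (fun _ : ι => ℂ) 2) : A x = B x :=
  unitVec_induction (p := fun x => A x = B x) x h (by simp)
    (fun x y hx hy => by rw [map_add, map_add, hx, hy])
    (fun c x hx => by rw [map_smul, map_smul, hx]) (isClosed_eq A.continuous B.continuous)

variable [CompleteSpace E]

/-- The isometry of `ℓ²(ι)` which takes the standard basis to a given orthonormal family. -/
def ofOrthonormal (v : ι → E) (hv : Orthonormal ℂ v) : lp (fun _ : ι => ℂ) 2 →ₗᵢ[ℂ] E :=
  hv.orthogonalFamily.linearIsometry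

theorem ofOrthonormal_unitVec (v : ι → E) (hv : Orthonormal ℂ v) (i : ι) :
    ofOrthonormal v hv (unitVec i) = v i := by
  rw [ofOrthonormal, unitVec, OrthogonalFamily.linearIsometry_apply_single]
  simp

theorem isClosed_range_isometry {F : Type*} [NormedAddCommGroup F] [NormedSpace ℂ F]
    (A : E →ₗᵢ[ℂ] F) : IsClosed (LinearMap.range A.toLinearMap : Set F) := by
  have h := A.isometry.isClosedEmbedding.isClosed_range
  rwa [← LinearIsometry.coe_toLinearMap, ← LinearMap.coe_range] at h

end Basis

/-! ### The Hardy space over the disc -/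

/-- `H²(𝔻)`, given by Taylor coefficients. -/
abbrev H1 : Type := lp (fun _ : ℕ => ℂ) 2

/-- The unilateral shift. -/
def unilateralShift : H1 →ₗᵢ[ℂ] H1 :=
  ofOrthonormal (fun n => unitVec (n + 1)) (orthonormal_unitVec.comp _ (add_left_injective 1))

theorem unilateralShift_unitVec (n : ℕ) : unilateralShift (unitVec n) = unitVec (n + 1) :=
  ofOrthonormal_unitVec _ _ n

/-- Multiplication by `z ^ n` on `H²(𝔻)`. -/
def shiftPow : ℕ → H1 →ₗᵢ[ℂ] H1
  | 0 => LinearIsometry.id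
  | n + 1 => unilateralShift.comp (shiftPow n)

theorem shiftPow_zero (x : H1) : shiftPow 0 x = x := rfl

theorem shiftPow_succ (n : ℕ) (x : H1) : shiftPow (n + 1) x = unilateralShift (shiftPow n x) := rfl

theorem shiftPow_one (x : H1) : shiftPow 1 x = unilateralShift x := rfl

theorem shiftPow_add (m n : ℕ) (x : H1) : shiftPow (m + n) x = shiftPow m (shiftPow n x) := by
  induction m with
  | zero => simp [shiftPow_zero]
  | succ m ih => rw [Nat.succ_add, shiftPow_succ, shiftPow_succ, ih]

theorem shiftPow_unitVec (m n : ℕ) : shiftPow m (unitVec n) = unitVec (m + n) := by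
  induction m with
  | zero => simp [shiftPow_zero]
  | succ m ih => rw [shiftPow_succ, ih, unilateralShift_unitVec, Nat.succ_add]

theorem shiftPow_apply_add (m n : ℕ) (x : H1) : shiftPow m x (m + n) = x n := by
  rw [← inner_unitVec_left, ← shiftPow_unitVec, LinearIsometry.inner_map_map, inner_unitVec_left]

theorem shiftPow_apply_of_lt {m n : ℕ} (h : n < m) (x : H1) : shiftPow m x n = 0 := by
  refine unitVec_induction (p := fun x => shiftPow m x n = 0) x (fun i => ?_) (by simp)
    (fun x y hx hy => by simp [hx, hy]) (fun c x hx => by simp [hx]) ?_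
  · rw [shiftPow_unitVec, unitVec_apply, if_neg (by omega)]
  · simp only [← inner_unitVec_left]
    exact isClosed_eq (by fun_prop) continuous_const

/-- A function divisible by zⁿ⁺¹ has vanishing n-th coefficient. This purity of the shift is what
produces wandering vectors. -/
theorem eq_zero_of_forall_mem_range_shiftPow {x : H1} (h : ∀ n, ∃ y, shiftPow n y = x) : x = 0 := by
  ext n
  obtain ⟨y, rfl⟩ := h (n + 1)
  exact shiftPow_apply_of_lt n.lt_succ_self y

/-! ### Tensor products of one-variable functions -/

/-- The function `(z, w) ↦ a(z) b(w)`. -/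
def ten (a b : H1) : H2 :=
  ⟨fun p => a p.1 * b p.2, by
    have ha := (lp.memℓp a).summable (by norm_num)
    have hb := (lp.memℓp b).summable (by norm_num)
    refine memℓp_gen ((ha.mul_of_nonneg hb (fun _ => by positivity)
      (fun _ => by positivity)).congr fun p => ?_)
    rw [norm_mul, Real.mul_rpow (norm_nonneg _) (norm_nonneg _)]⟩

theorem ten_apply (a b : H1) (p : ℕ × ℕ) : ten a b p = a p.1 * b p.2 := rfl

theorem ten_add_left (a a' b : H1) : ten (a + a') b = ten a b + ten a' b := by
  ext p; simp [ten_apply, add_mul]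

theorem ten_add_right (a b b' : H1) : ten a (b + b') = ten a b + ten a b' := by
  ext p; simp [ten_apply, mul_add]

theorem ten_smul_left (c : ℂ) (a b : H1) : ten (c • a) b = c • ten a b := by
  ext p; simp [ten_apply, mul_assoc]

theorem ten_smul_right (c : ℂ) (a b : H1) : ten a (c • b) = c • ten a b := by
  ext p; simp [ten_apply, mul_left_comm]

theorem ten_unitVec (j k : ℕ) : ten (unitVec j) (unitVec k) = unitVec (j, k) := by
  ext p
  simp only [ten_apply, unitVec_apply, Prod.ext_iff]
  split_ifs <;> simp_all

theorem hasSum_inner_coeff {ι : Type*} (x y : lp (fun _ : ι => ℂ) 2) :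
    HasSum (fun i => y i * starRingEnd ℂ (x i)) ⟪x, y⟫_ℂ :=
  lp.hasSum_inner (𝕜 := ℂ) x y

theorem hasSum_mul_prod {f g : ℕ → ℂ} {s t : ℂ} (hf : HasSum f s) (hg : HasSum g t) :
    HasSum (fun p : ℕ × ℕ => f p.1 * g p.2) (s * t) := by
  have hs : Summable fun p : ℕ × ℕ => f p.1 * g p.2 :=
    summable_mul_of_summable_norm hf.summable.norm hg.summable.norm
  exact hf.mul hg hs

theorem inner_ten (a b c d : H1) : ⟪ten a b, ten c d⟫_ℂ = ⟪a, c⟫_ℂ * ⟪b, d⟫_ℂ := by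
  have h3 := hasSum_mul_prod (hasSum_inner_coeff a c) (hasSum_inner_coeff b d)
  have h4 : (fun p : ℕ × ℕ => c p.1 * starRingEnd ℂ (a p.1) * (d p.2 * starRingEnd ℂ (b p.2))) =
      fun p => ten c d p * starRingEnd ℂ (ten a b p) := by
    funext p
    rw [ten_apply, ten_apply, map_mul]
    ring
  rw [h4] at h3
  exact (hasSum_inner_coeff (ten a b) (ten c d)).unique h3

theorem norm_ten (a b : H1) : ‖ten a b‖ = ‖a‖ * ‖b‖ := by
  have h := inner_ten a b a b
  rw [inner_self_eq_norm_sq_to_K, inner_self_eq_norm_sq_to_K, inner_self_eq_norm_sq_to_K] at h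
  have h2 : ‖ten a b‖ ^ 2 = (‖a‖ * ‖b‖) ^ 2 := by
    rw [mul_pow]
    exact_mod_cast h
  exact (pow_left_inj₀ (norm_nonneg _) (by positivity) two_ne_zero).1 h2

/-- `a ↦ a ⊗ b` -/
def tenRight (b : H1) : H1 →L[ℂ] H2 :=
  LinearMap.mkContinuous
    { toFun := fun a => ten a b
      map_add' := fun a a' => ten_add_left a a' b
      map_smul' := fun c a => ten_smul_left c a b } ‖b‖
    fun a => by
      change ‖ten a b‖ ≤ _
      rw [norm_ten, mul_comm]

/-- `b ↦ a ⊗ b` -/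
def tenLeft (a : H1) : H1 →L[ℂ] H2 :=
  LinearMap.mkContinuous
    { toFun := fun b => ten a b
      map_add' := fun b b' => ten_add_right a b b'
      map_smul' := fun c b => ten_smul_right c a b } ‖a‖
    fun b => (norm_ten a b).le

theorem tenRight_apply (a b : H1) : tenRight b a = ten a b := rfl

theorem tenLeft_apply (a b : H1) : tenLeft a b = ten a b := rfl

/-! ### Coordinate shifts and monomial multipliers -/

theorem Mz_unitVec (p : ℕ × ℕ) : Mz (unitVec p) = unitVec (p.1 + 1, p.2) := by
  ext q
  by_cases hq : ∃ r : ℕ × ℕ, (r.1 + 1, r.2) = q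
  · obtain ⟨r, rfl⟩ := hq
    refine (shift_apply _ injective_succ_fst _ r).trans ?_
    simp [unitVec_apply, Prod.ext_iff]
  · refine (shift_apply_of_notMem _ injective_succ_fst _ q hq).trans ?_
    rw [unitVec_apply, if_neg]
    rintro rfl
    exact hq ⟨p, rfl⟩

theorem Mw_unitVec (p : ℕ × ℕ) : Mw (unitVec p) = unitVec (p.1, p.2 + 1) := by
  ext q
  by_cases hq : ∃ r : ℕ × ℕ, (r.1, r.2 + 1) = q
  · obtain ⟨r, rfl⟩ := hq
    refine (shift_apply _ injective_succ_snd _ r).trans ?_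
    simp [unitVec_apply, Prod.ext_iff]
  · refine (shift_apply_of_notMem _ injective_succ_snd _ q hq).trans ?_
    rw [unitVec_apply, if_neg]
    rintro rfl
    exact hq ⟨p, rfl⟩

theorem inner_Mz_Mz (x y : H2) : ⟪Mz x, Mz y⟫_ℂ = ⟪x, y⟫_ℂ :=
  (shift _ injective_succ_fst).inner_map_map x y

theorem inner_Mw_Mw (x y : H2) : ⟪Mw x, Mw y⟫_ℂ = ⟪x, y⟫_ℂ :=
  (shift _ injective_succ_snd).inner_map_map x y

theorem Mz_Mw (x : H2) : Mz (Mw x) = Mw (Mz x) :=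
  clm_ext_unitVec (A := Mz ∘L Mw) (B := Mw ∘L Mz) (fun p => by simp [Mz_unitVec, Mw_unitVec]) x

theorem Mz_ten (a b : H1) : Mz (ten a b) = ten (unilateralShift a) b := by
  refine clm_ext_unitVec (A := Mz ∘L tenRight b)
    (B := tenRight b ∘L unilateralShift.toContinuousLinearMap) (fun j => ?_) a
  refine clm_ext_unitVec (A := Mz ∘L tenLeft (unitVec j))
    (B := tenLeft (unilateralShift (unitVec j))) (fun k => ?_) b
  simp [tenLeft_apply, unilateralShift_unitVec, ten_unitVec, Mz_unitVec]

theorem Mw_ten (a b : H1) : Mw (ten a b) = ten a (unilateralShift b) := by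
  refine clm_ext_unitVec (A := Mw ∘L tenRight b)
    (B := tenRight (unilateralShift b)) (fun j => ?_) a
  refine clm_ext_unitVec (A := Mw ∘L tenLeft (unitVec j))
    (B := tenLeft (unitVec j) ∘L unilateralShift.toContinuousLinearMap) (fun k => ?_) b
  simp [tenLeft_apply, unilateralShift_unitVec, ten_unitVec, Mw_unitVec]

theorem Mz_pow_ten (n : ℕ) (a b : H1) : (Mz ^ n) (ten a b) = ten (shiftPow n a) b := by
  induction n with
  | zero => rfl
  | succ n ih => rw [pow_succ', mul_apply_eq_comp, ih, Mz_ten, shiftPow_succ]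

theorem Mw_pow_ten (n : ℕ) (a b : H1) : (Mw ^ n) (ten a b) = ten a (shiftPow n b) := by
  induction n with
  | zero => rfl
  | succ n ih => rw [pow_succ', mul_apply_eq_comp, ih, Mw_ten, shiftPow_succ]

/-- Multiplication by the monomial `z ^ p.1 * w ^ p.2`. -/
def monoMul (p : ℕ × ℕ) : H2 →L[ℂ] H2 := Mz ^ p.1 * Mw ^ p.2

theorem monoMul_ten (p : ℕ × ℕ) (a b : H1) :
    monoMul p (ten a b) = ten (shiftPow p.1 a) (shiftPow p.2 b) := by
  rw [monoMul, mul_apply_eq_comp, Mw_pow_ten, Mz_pow_ten]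

theorem monoMul_unitVec (p q : ℕ × ℕ) : monoMul p (unitVec q) = unitVec (p + q) := by
  rw [← Prod.mk.eta (p := q), ← ten_unitVec, monoMul_ten, shiftPow_unitVec, shiftPow_unitVec,
    ten_unitVec]
  rfl

theorem monoMul_add (p q : ℕ × ℕ) (x : H2) : monoMul (p + q) x = monoMul p (monoMul q x) :=
  clm_ext_unitVec (A := monoMul (p + q)) (B := monoMul p ∘L monoMul q)
    (fun r => by simp [monoMul_unitVec, add_assoc]) x

theorem inner_monoMul (p : ℕ × ℕ) (x y : H2) : ⟪monoMul p x, monoMul p y⟫_ℂ = ⟪x, y⟫_ℂ := by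
  have hz : ∀ n x y, ⟪(Mz ^ n) x, (Mz ^ n) y⟫_ℂ = ⟪x, y⟫_ℂ := by
    intro n
    induction n with
    | zero => intro x y; rfl
    | succ n ih =>
      intro x y
      rw [pow_succ', mul_apply_eq_comp, mul_apply_eq_comp, inner_Mz_Mz, ih]
  have hw : ∀ n x y, ⟪(Mw ^ n) x, (Mw ^ n) y⟫_ℂ = ⟪x, y⟫_ℂ := by
    intro n
    induction n with
    | zero => intro x y; rfl
    | succ n ih =>
      intro x y
      rw [pow_succ', mul_apply_eq_comp, mul_apply_eq_comp, inner_Mw_Mw, ih]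
  rw [monoMul, mul_apply_eq_comp, mul_apply_eq_comp, hz, hw]

theorem norm_monoMul (p : ℕ × ℕ) (x : H2) : ‖monoMul p x‖ = ‖x‖ := by
  rw [@norm_eq_sqrt_re_inner ℂ, inner_monoMul, ← @norm_eq_sqrt_re_inner ℂ]

theorem monoMul_mem {S : Submodule ℂ H2} (hS : IsHardySubmodule S) {x : H2} (hx : x ∈ S)
    (p : ℕ × ℕ) : monoMul p x ∈ S := by
  have hw : ∀ n, (Mw ^ n) x ∈ S := by
    intro n
    induction n with
    | zero => exact hx
    | succ n ih => rw [pow_succ', mul_apply_eq_comp]; exact hS.mw_mem _ ih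
  have hz : ∀ n, ∀ y ∈ S, (Mz ^ n) y ∈ S := by
    intro n
    induction n with
    | zero => intro y hy; exact hy
    | succ n ih =>
      intro y hy
      rw [pow_succ', mul_apply_eq_comp]; exact hS.mz_mem _ (ih y hy)
  exact hz _ _ (hw _)

/-! ### Isometric multipliers and Beurling's theorem -/

/-- `φ` multiplies `H²(𝔻)` isometrically into itself: the functions `zⁿ φ` are orthonormal. -/
def IsIsometricMultiplier (φ : H1) : Prop := Orthonormal ℂ fun n => shiftPow n φ

theorem isIsometricMultiplier_unitVec_zero : IsIsometricMultiplier (unitVec 0) := by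
  have : (fun n => shiftPow n (unitVec 0)) = (unitVec : ℕ → H1) := by
    funext n
    rw [shiftPow_unitVec, add_zero]
  rw [IsIsometricMultiplier, this]
  exact orthonormal_unitVec

/-- The shift is an isometry, so orthogonality of zᵐφ and zⁿφ reduces to that of φ and zⁿ⁻ᵐφ. -/
theorem isIsometricMultiplier_of_wandering {φ : H1} (h1 : ‖φ‖ = 1)
    (h : ∀ n, ⟪φ, shiftPow (n + 1) φ⟫_ℂ = 0) : IsIsometricMultiplier φ := by
  have key : ∀ m n, m < n → ⟪shiftPow m φ, shiftPow n φ⟫_ℂ = 0 := by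
    intro m n hmn
    obtain ⟨k, rfl⟩ := Nat.exists_eq_add_of_lt hmn
    rw [add_assoc, shiftPow_add, LinearIsometry.inner_map_map, h]
  refine ⟨fun n => by rw [LinearIsometry.norm_map, h1], fun m n hmn => ?_⟩
  rcases lt_or_gt_of_ne hmn with hlt | hlt
  · exact key m n hlt
  · exact inner_eq_zero_symm.1 (key n m hlt)

/-- Multiplication by `φ` on `H²(𝔻)`. -/
def mulOp (φ : H1) (hφ : IsIsometricMultiplier φ) : H1 →ₗᵢ[ℂ] H1 := ofOrthonormal _ hφ

theorem mulOp_unitVec {φ : H1} (hφ : IsIsometricMultiplier φ) (n : ℕ) :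
    mulOp φ hφ (unitVec n) = shiftPow n φ :=
  ofOrthonormal_unitVec _ _ n

theorem mulOp_unitVec_zero {φ : H1} (hφ : IsIsometricMultiplier φ) :
    mulOp φ hφ (unitVec 0) = φ :=
  mulOp_unitVec hφ 0

theorem mulOp_one (x : H1) : mulOp (unitVec 0) isIsometricMultiplier_unitVec_zero x = x :=
  clm_ext_unitVec (A := (mulOp _ isIsometricMultiplier_unitVec_zero).toContinuousLinearMap)
    (B := ContinuousLinearMap.id ℂ H1)
    (fun n => by simp [mulOp_unitVec, shiftPow_unitVec]) x

theorem mulOp_apply {φ : H1} (hφ : IsIsometricMultiplier φ) (x : H1) (n : ℕ) :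
    mulOp φ hφ x n = ∑ p ∈ Finset.HasAntidiagonal.antidiagonal n, φ p.1 * x p.2 := by
  refine unitVec_induction
    (p := fun x => mulOp φ hφ x n = ∑ p ∈ Finset.HasAntidiagonal.antidiagonal n, φ p.1 * x p.2) x
    (fun k => ?_) (by simp) (fun x y hx hy => ?_) (fun c x hx => ?_) ?_
  · simp only [mulOp_unitVec, unitVec_apply, mul_ite, mul_one, mul_zero]
    rcases lt_or_ge n k with h | h
    · rw [shiftPow_apply_of_lt h, Finset.sum_eq_zero]
      intro p hp
      rw [if_neg]
      have := Finset.HasAntidiagonal.mem_antidiagonal.1 hp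
      omega
    · obtain ⟨m, rfl⟩ := Nat.exists_eq_add_of_le h
      rw [shiftPow_apply_add, Finset.sum_eq_single (m, k)]
      · simp
      · rintro ⟨a, b⟩ hp hne
        rw [if_neg]
        rintro rfl
        have := Finset.HasAntidiagonal.mem_antidiagonal.1 hp
        simp only at this
        exact hne (by rw [show a = m by omega])
      · intro hp
        exact absurd (Finset.HasAntidiagonal.mem_antidiagonal.2 (add_comm m k)) hp
  · simp [mul_add, Finset.sum_add_distrib, hx, hy]
  · simp [hx, Finset.mul_sum, mul_left_comm]
  · simp only [← inner_unitVec_left]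
    exact isClosed_eq (by fun_prop) (by fun_prop)

/-- Both sides have the Cauchy product as coefficients. This commutativity forces uniqueness of the
wandering direction in Beurling's theorem. -/
theorem mulOp_comm {φ ψ : H1} (hφ : IsIsometricMultiplier φ) (hψ : IsIsometricMultiplier ψ) :
    mulOp φ hφ ψ = mulOp ψ hψ φ := by
  ext n
  rw [mulOp_apply, mulOp_apply, ← Finset.Nat.sum_antidiagonal_swap]
  exact Finset.sum_congr rfl fun p _ => mul_comm _ _

theorem shiftPow_mem {K : Submodule ℂ H1} (hinv : ∀ x ∈ K, unilateralShift x ∈ K) {x : H1}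
    (hx : x ∈ K) (n : ℕ) : shiftPow n x ∈ K := by
  induction n with
  | zero => exact hx
  | succ n ih => exact hinv _ ih

theorem range_mulOp_le {K : Submodule ℂ H1} (hK : IsClosed (K : Set H1))
    (hinv : ∀ x ∈ K, unilateralShift x ∈ K) {φ : H1} (hφ : IsIsometricMultiplier φ)
    (hmem : φ ∈ K) (x : H1) : mulOp φ hφ x ∈ K := by
  refine mem_of_unitVec_mem (K := K.comap (mulOp φ hφ).toLinearMap)
    (hK.preimage (mulOp φ hφ).continuous) (fun n => ?_) x
  change mulOp φ hφ (unitVec n) ∈ K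
  rw [mulOp_unitVec]
  exact shiftPow_mem hinv hmem n

/-- A nonzero closed invariant subspace has a nonzero wandering vector. -/
theorem exists_wandering {K : Submodule ℂ H1} (hK : IsClosed (K : Set H1))
    (hinv : ∀ x ∈ K, unilateralShift x ∈ K) (hne : K ≠ ⊥) :
    ∃ φ ∈ K, ‖φ‖ = 1 ∧ ∀ x ∈ K, ⟪φ, unilateralShift x⟫_ℂ = 0 := by
  by_contra! hcon
  set K' : Submodule ℂ H1 := K.map unilateralShift.toLinearMap with hK'
  have hK'c : IsClosed (K' : Set H1) := by
    have := unilateralShift.isometry.isClosedEmbedding.isClosedMap _ hK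
    rwa [hK', Submodule.map_coe]
  have : CompleteSpace K' := hK'c.completeSpace_coe
  have hle : K' ≤ K := by
    rintro _ ⟨x, hx, rfl⟩
    exact hinv x hx
  -- The component of x orthogonal to zK, once normalized, would be a wandering unit vector; having
  -- none forces K = zK.
  have hsurj : K ≤ K' := by
    intro x hx
    by_contra hxn
    set y := x - K'.starProjection x with hy
    have hyK : y ∈ K := K.sub_mem hx (hle (K'.starProjection_apply_mem x))
    have hy0 : y ≠ 0 := fun h0 => hxn (by
      rw [sub_eq_zero.1 h0]
      exact K'.starProjection_apply_mem x)
    have hyo : y ∈ K'ᗮ := K'.sub_starProjection_mem_orthogonal x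
    obtain ⟨u, hu, hne⟩ := hcon (((‖y‖ : ℂ)⁻¹) • y) (K.smul_mem _ hyK) (by
      rw [norm_smul, norm_inv, Complex.norm_real, norm_norm,
        inv_mul_cancel₀ (norm_ne_zero_iff.2 hy0)])
    apply hne
    have h0 : ⟪y, unilateralShift u⟫_ℂ = 0 :=
      (Submodule.mem_orthogonal' _ _).1 hyo _ ⟨u, hu, rfl⟩
    rw [inner_smul_left, h0, mul_zero]
  apply hne
  rw [eq_bot_iff]
  intro x hx
  -- Iterating K = zK makes every element of K divisible by all powers of z, hence zero.
  have key : ∀ n, ∀ x ∈ K, ∃ y ∈ K, shiftPow n y = x := by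
    intro n
    induction n with
    | zero => exact fun x hx => ⟨x, hx, rfl⟩
    | succ n ih =>
      intro x hx
      obtain ⟨y, hy, rfl⟩ := hsurj hx
      obtain ⟨z, hz, rfl⟩ := ih y hy
      exact ⟨z, hz, rfl⟩
  exact eq_zero_of_forall_mem_range_shiftPow fun n =>
    let ⟨y, _, hy⟩ := key n x hx
    ⟨y, hy⟩

theorem inner_mulOp_eq_zero {φ x : H1} (hφ : IsIsometricMultiplier φ)
    (h : ∀ n, ⟪x, shiftPow n φ⟫_ℂ = 0) (y : H1) : ⟪x, mulOp φ hφ y⟫_ℂ = 0 := by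
  refine clm_ext_unitVec (A := innerSL ℂ x ∘L (mulOp φ hφ).toContinuousLinearMap) (B := 0)
    (fun n => ?_) y
  simpa [mulOp_unitVec] using h n

/-- **Beurling's theorem** -/
theorem exists_eq_range_mulOp {K : Submodule ℂ H1} (hK : IsClosed (K : Set H1))
    (hinv : ∀ x ∈ K, unilateralShift x ∈ K) (hne : K ≠ ⊥) :
    ∃ φ : H1, ∃ hφ : IsIsometricMultiplier φ, φ ∈ K ∧ ∀ x ∈ K, ∃ y, mulOp φ hφ y = x := by
  obtain ⟨φ, hφK, hφ1, hφo⟩ := exists_wandering hK hinv hne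
  have hφ : IsIsometricMultiplier φ :=
    isIsometricMultiplier_of_wandering hφ1 fun n => hφo _ (shiftPow_mem hinv hφK n)
  refine ⟨φ, hφ, hφK, fun x hx => ?_⟩
  set R : Submodule ℂ H1 := LinearMap.range (mulOp φ hφ).toLinearMap with hR
  have hRc : IsClosed (R : Set H1) := isClosed_range_isometry _
  have : CompleteSpace R := hRc.completeSpace_coe
  set K' : Submodule ℂ H1 := K ⊓ Rᗮ with hK'
  have horth : ∀ y ∈ K', ∀ n, ⟪y, shiftPow n φ⟫_ℂ = 0 := fun y hy n =>
    (Submodule.mem_orthogonal' _ _).1 hy.2 _ ⟨unitVec n, mulOp_unitVec hφ n⟩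
  have hK'c : IsClosed (K' : Set H1) := hK.inter R.isClosed_orthogonal
  -- The element zy is orthogonal to φ because φ is wandering, and to zⁿ⁺¹φ because y is orthogonal
  -- to zⁿφ.
  have hK'inv : ∀ y ∈ K', unilateralShift y ∈ K' := by
    intro y hy
    refine ⟨hinv y hy.1, (Submodule.mem_orthogonal' _ _).2 ?_⟩
    rintro _ ⟨u, rfl⟩
    refine inner_mulOp_eq_zero hφ (fun n => ?_) u
    cases n with
    | zero => exact inner_eq_zero_symm.1 (hφo y hy.1)
    | succ n => rw [shiftPow_succ, LinearIsometry.inner_map_map, horth y hy n]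
  -- A wandering ψ in K' would put ψφ = φψ both in K', which is orthogonal to φH², and in φH²
  -- itself. Then ψφ = 0, although multiplication by ψ is isometric and ‖φ‖ = 1.
  have hbot : K' = ⊥ := by
    by_contra hK'ne
    obtain ⟨ψ, hψK, hψ1, hψo⟩ := exists_wandering hK'c hK'inv hK'ne
    have hψ : IsIsometricMultiplier ψ :=
      isIsometricMultiplier_of_wandering hψ1 fun n => hψo _ (shiftPow_mem hK'inv hψK n)
    have h1 : mulOp ψ hψ φ ∈ K' := range_mulOp_le hK'c hK'inv hψ hψK φ
    have h2 : ⟪mulOp ψ hψ φ, mulOp φ hφ ψ⟫_ℂ = 0 :=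
      (Submodule.mem_orthogonal' _ _).1 h1.2 _ ⟨ψ, rfl⟩
    rw [mulOp_comm hφ hψ, LinearIsometry.inner_map_map, inner_self_eq_zero] at h2
    rw [h2, norm_zero] at hφ1
    exact zero_ne_one hφ1
  have hmem : x - R.starProjection x ∈ K' :=
    ⟨K.sub_mem hx (by
      obtain ⟨u, hu⟩ := R.starProjection_apply_mem x
      rw [← hu]
      exact range_mulOp_le hK hinv hφ hφK u), R.sub_starProjection_mem_orthogonal x⟩
  rw [hbot, Submodule.mem_bot, sub_eq_zero] at hmem
  obtain ⟨u, hu⟩ := R.starProjection_apply_mem x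
  exact ⟨u, hu.trans hmem.symm⟩

/-- The backward shifts of `φ` span the orthogonal complement of `φ H²(𝔻)`. -/
theorem mem_range_mulOp {φ x : H1} (hφ : IsIsometricMultiplier φ)
    (h : ∀ n, ⟪φ, shiftPow (n + 1) x⟫_ℂ = 0) : ∃ y, mulOp φ hφ y = x := by
  -- N is the complement of the backward shifts of φ. It is closed, invariant and contains φ, so
  -- Beurling gives N = χH²; the aim is that φ is a multiple of χ.
  let N : Submodule ℂ H1 :=
    { carrier := {x | ∀ n, ⟪φ, shiftPow (n + 1) x⟫_ℂ = 0}
      add_mem' := fun {x y} hx hy n => by rw [map_add, inner_add_right, hx n, hy n, add_zero]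
      zero_mem' := fun n => by rw [map_zero, inner_zero_right]
      smul_mem' := fun c x hx n => by rw [map_smul, inner_smul_right, hx n, mul_zero] }
  have hNc : IsClosed (N : Set H1) := by
    change IsClosed {x | ∀ n, ⟪φ, shiftPow (n + 1) x⟫_ℂ = 0}
    rw [Set.ofPred_forall]
    exact isClosed_iInter fun n => isClosed_eq (by fun_prop) continuous_const
  have hNinv : ∀ y ∈ N, unilateralShift y ∈ N := fun y hy n => by
    rw [← shiftPow_one, ← shiftPow_add]
    exact hy (n + 1)
  have hφN : φ ∈ N := fun n => hφ.2 (Nat.succ_ne_zero n).symm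
  have hφ0 : φ ≠ 0 := hφ.ne_zero 0
  have hNne : N ≠ ⊥ := fun h0 => hφ0 (by rwa [h0, Submodule.mem_bot] at hφN)
  obtain ⟨χ, hχ, hχN, hχr⟩ := exists_eq_range_mulOp hNc hNinv hNne
  obtain ⟨y, hy⟩ := hχr φ hφN
  -- As χ ∈ N, 0 = ⟨φ, zⁿ⁺¹χ⟩ = ⟨χy, χzⁿ⁺¹⟩ = ⟨y, zⁿ⁺¹⟩, so y is constant.
  have hy' : y = y 0 • unitVec 0 := by
    ext n
    cases n with
    | zero => simp [unitVec_apply]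
    | succ n =>
      have := hχN n
      rw [← hy, ← mulOp_unitVec hχ, LinearIsometry.inner_map_map] at this
      rw [← inner_unitVec_left, inner_eq_zero_symm.1 this]
      simp [unitVec_apply]
  have hφχ : φ = y 0 • χ := by
    rw [← hy, hy', map_smul, mulOp_unitVec_zero]
    simp [unitVec_apply]
  have hc : y 0 ≠ 0 := fun h0 => hφ0 (by rw [hφχ, h0, zero_smul])
  obtain ⟨u, rfl⟩ := hχr x h
  refine ⟨(y 0)⁻¹ • u, ?_⟩
  refine clm_ext_unitVec (A := (mulOp φ hφ).toContinuousLinearMap ∘L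
    ((y 0)⁻¹ • ContinuousLinearMap.id ℂ H1)) (B := (mulOp χ hχ).toContinuousLinearMap)
    (fun n => ?_) u
  simp [mulOp_unitVec, hφχ, smul_smul, hc]

/-! ### Multiplication by `φ₁(z) φ₂(w)` -/

section MulTen

variable {φ₁ φ₂ : H1} (h₁ : IsIsometricMultiplier φ₁) (h₂ : IsIsometricMultiplier φ₂)

theorem orthonormal_ten_shiftPow {φ₁ φ₂ : H1} (h₁ : IsIsometricMultiplier φ₁)
    (h₂ : IsIsometricMultiplier φ₂) :
    Orthonormal ℂ fun p : ℕ × ℕ => ten (shiftPow p.1 φ₁) (shiftPow p.2 φ₂) := by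
  rw [orthonormal_iff_ite]
  intro p q
  rw [inner_ten, orthonormal_iff_ite.1 h₁, orthonormal_iff_ite.1 h₂]
  simp only [Prod.ext_iff]
  split_ifs <;> simp_all

/-- Multiplication by `φ₁(z) φ₂(w)` on `H²(𝔻²)`. -/
def mulTen : H2 →ₗᵢ[ℂ] H2 := ofOrthonormal _ (orthonormal_ten_shiftPow h₁ h₂)

theorem mulTen_unitVec (p : ℕ × ℕ) :
    mulTen h₁ h₂ (unitVec p) = ten (shiftPow p.1 φ₁) (shiftPow p.2 φ₂) :=
  ofOrthonormal_unitVec _ _ p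

theorem mulTen_ten (a b : H1) :
    mulTen h₁ h₂ (ten a b) = ten (mulOp φ₁ h₁ a) (mulOp φ₂ h₂ b) := by
  refine clm_ext_unitVec (A := (mulTen h₁ h₂).toContinuousLinearMap ∘L tenRight b)
    (B := tenRight (mulOp φ₂ h₂ b) ∘L (mulOp φ₁ h₁).toContinuousLinearMap) (fun j => ?_) a
  refine clm_ext_unitVec (A := (mulTen h₁ h₂).toContinuousLinearMap ∘L tenLeft (unitVec j))
    (B := tenLeft (mulOp φ₁ h₁ (unitVec j)) ∘L (mulOp φ₂ h₂).toContinuousLinearMap)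
    (fun k => ?_) b
  simp [tenLeft_apply, ten_unitVec, mulTen_unitVec, mulOp_unitVec]

theorem mulTen_monoMul (p : ℕ × ℕ) (x : H2) :
    mulTen h₁ h₂ (monoMul p x) = monoMul p (mulTen h₁ h₂ x) := by
  refine clm_ext_unitVec (A := (mulTen h₁ h₂).toContinuousLinearMap ∘L monoMul p)
    (B := monoMul p ∘L (mulTen h₁ h₂).toContinuousLinearMap) (fun q => ?_) x
  simp [monoMul_unitVec, mulTen_unitVec, monoMul_ten, shiftPow_add]

theorem range_mulTen_le {S : Submodule ℂ H2} (hS : IsHardySubmodule S)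
    (hmem : ten φ₁ φ₂ ∈ S) (x : H2) : mulTen h₁ h₂ x ∈ S := by
  refine mem_of_unitVec_mem (K := S.comap (mulTen h₁ h₂).toLinearMap)
    (hS.isClosed.preimage (mulTen h₁ h₂).continuous) (fun p => ?_) x
  change mulTen h₁ h₂ (unitVec p) ∈ S
  rw [mulTen_unitVec, ← monoMul_ten]
  exact monoMul_mem hS hmem p

end MulTen

/-! ### The structure of doubly commuting quotient modules -/

section Abstract

variable {K : Type*} [NormedAddCommGroup K] [InnerProductSpace ℂ K] [CompleteSpace K]

open ContinuousLinearMap in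
theorem adjoint_comm {A B : K →L[ℂ] K} (h : ∀ x, A (adjoint B x) = adjoint B (A x)) (x : K) :
    B (adjoint A x) = adjoint A (B x) := by
  refine ext_inner_left ℂ fun y => ?_
  rw [← adjoint_inner_left, adjoint_inner_right, h, adjoint_inner_left, adjoint_inner_right]

open ContinuousLinearMap in
/-- If `A`, `B` doubly commute and `(1 - A A†)(1 - B B†)` is the rank one operator given by a vector
`κ`, then the Gram matrix of the vectors `A^j B^k κ` is a tensor product. -/
theorem exists_gram_factorization {A B : K →L[ℂ] K} (hAB : ∀ x, A (B x) = B (A x))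
    (hAB' : ∀ x, A (adjoint B x) = adjoint B (A x)) {κ : K} (hκ : κ ≠ 0)
    (hrank : ∀ x, (x - B (adjoint B x)) - A (adjoint A (x - B (adjoint B x))) = ⟪κ, x⟫_ℂ • κ) :
    ∃ c : ℂ, c ≠ 0 ∧ ∀ j k m n : ℕ, ⟪(A ^ j) ((B ^ k) κ), (A ^ m) ((B ^ n) κ)⟫_ℂ =
      c * (⟪(A ^ j) κ, (A ^ m) κ⟫_ℂ * ⟪(B ^ k) κ, (B ^ n) κ⟫_ℂ) := by
  have hBA' : ∀ x, B (adjoint A x) = adjoint A (B x) := fun x => by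
    exact adjoint_comm hAB' x
  have hA'B' : ∀ x, adjoint A (adjoint B x) = adjoint B (adjoint A x) := fun x => by
    refine ext_inner_left ℂ fun y => ?_
    rw [adjoint_inner_right, adjoint_inner_right, adjoint_inner_right, adjoint_inner_right, hAB]
  obtain ⟨X, hX⟩ : ∃ X : K →L[ℂ] K, ∀ x, X x = x - A (adjoint A x) :=
    ⟨ContinuousLinearMap.id ℂ K - A ∘L adjoint A, fun x => by simp⟩
  obtain ⟨Y, hY⟩ : ∃ Y : K →L[ℂ] K, ∀ x, Y x = x - B (adjoint B x) :=
    ⟨ContinuousLinearMap.id ℂ K - B ∘L adjoint B, fun x => by simp⟩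
  have hXY : ∀ x, X (Y x) = ⟪κ, x⟫_ℂ • κ := fun x => by rw [hX, hY, hrank]
  have hXB : ∀ x, X (B x) = B (X x) := fun x => by
    rw [hX, hX, map_sub, ← hAB, hBA']
  have hXB' : ∀ x, X (adjoint B x) = adjoint B (X x) := fun x => by
    rw [hX, hX, map_sub, ← hAB', hA'B']
  have hYA : ∀ x, Y (A x) = A (Y x) := fun x => by
    rw [hY, hY, map_sub, hAB, hAB']
  have hYA' : ∀ x, Y (adjoint A x) = adjoint A (Y x) := fun x => by
    rw [hY, hY, map_sub, ← hBA', ← hA'B']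
  have hYX : ∀ x, Y (X x) = X (Y x) := fun x => by
    rw [hX, hX, map_sub, hYA, hYA']
  have hXs : ∀ x y, ⟪X x, y⟫_ℂ = ⟪x, X y⟫_ℂ := fun x y => by
    rw [hX, hX, inner_sub_left, inner_sub_right, ← adjoint_inner_left,
      ← adjoint_inner_right A _ y]
  have hYs : ∀ x y, ⟪Y x, y⟫_ℂ = ⟪x, Y y⟫_ℂ := fun x y => by
    rw [hY, hY, inner_sub_left, inner_sub_right, ← adjoint_inner_left,
      ← adjoint_inner_right B _ y]
  have hκκ : ⟪κ, κ⟫_ℂ ≠ 0 := inner_self_ne_zero.2 hκ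
  -- XY has range in the line of κ and commutes with X, so X preserves that line. The scalar is read
  -- off from ⟨κ, κ⟩Xκ = ⟨κ, Xκ⟩κ.
  obtain ⟨s, hs⟩ : ∃ s : ℂ, X κ = s • κ := by
    refine ⟨(⟪κ, κ⟫_ℂ)⁻¹ * ⟪κ, X κ⟫_ℂ, ?_⟩
    have h1 : X (X (Y κ)) = X (Y (X κ)) := by rw [hYX]
    rw [hXY, hXY, map_smul] at h1
    rw [mul_smul, ← h1, smul_smul, inv_mul_cancel₀ hκκ, one_smul]
  obtain ⟨t, ht⟩ : ∃ t : ℂ, Y κ = t • κ := by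
    refine ⟨(⟪κ, κ⟫_ℂ)⁻¹ * ⟪κ, Y κ⟫_ℂ, ?_⟩
    have h1 : Y (X (Y κ)) = X (Y (Y κ)) := by rw [hYX]
    rw [hXY, hXY, map_smul] at h1
    rw [mul_smul, ← h1, smul_smul, inv_mul_cancel₀ hκκ, one_smul]
  have hst : s * t ≠ 0 := by
    intro h0
    have h1 := hXY κ
    rw [ht, map_smul, hs, smul_smul, mul_comm t s, h0, zero_smul] at h1
    exact smul_ne_zero hκκ hκ h1.symm
  -- Y commutes with A and A*, and X with B and B*. So words in A, A* keep the Y-eigenvalue t, and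
  -- words in B, B* keep the X-eigenvalue s.
  have hAn : ∀ n x, Y x = t • x → Y ((A ^ n) x) = t • (A ^ n) x := by
    intro n
    induction n with
    | zero => exact fun x hx => hx
    | succ n ih => intro x hx; rw [pow_succ', mul_apply_eq_comp, hYA, ih x hx, map_smul]
  have hBn : ∀ n x, X x = s • x → X ((B ^ n) x) = s • (B ^ n) x := by
    intro n
    induction n with
    | zero => exact fun x hx => hx
    | succ n ih => intro x hx; rw [pow_succ', mul_apply_eq_comp, hXB, ih x hx, map_smul]
  have hA'n : ∀ n x, Y x = t • x → Y (((adjoint A) ^ n) x) = t • ((adjoint A) ^ n) x := by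
    intro n
    induction n with
    | zero => exact fun x hx => hx
    | succ n ih => intro x hx; rw [pow_succ', mul_apply_eq_comp, hYA', ih x hx, map_smul]
  have hB'n : ∀ n x, X x = s • x → X (((adjoint B) ^ n) x) = s • ((adjoint B) ^ n) x := by
    intro n
    induction n with
    | zero => exact fun x hx => hx
    | succ n ih => intro x hx; rw [pow_succ', mul_apply_eq_comp, hXB', ih x hx, map_smul]
  have adj : ∀ (C : K →L[ℂ] K) n x y, ⟪((adjoint C) ^ n) x, y⟫_ℂ = ⟪x, (C ^ n) y⟫_ℂ := by
    intro C n
    induction n with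
    | zero => exact fun x y => rfl
    | succ n ih =>
      intro x y
      rw [pow_succ', mul_apply_eq_comp, adjoint_inner_left, ih, pow_succ, mul_apply_eq_comp]
  have commBA' : Commute B (adjoint A) := ContinuousLinearMap.ext hBA'
  have commAB : Commute A B := ContinuousLinearMap.ext hAB
  have cAB : ∀ j k x, (A ^ j) ((B ^ k) x) = (B ^ k) ((A ^ j) x) := fun j k x =>
    congrArg (fun T : K →L[ℂ] K => T x) (commAB.pow_pow j k).eq
  have cBA' : ∀ k m x, (B ^ k) ((adjoint A ^ m) x) = (adjoint A ^ m) ((B ^ k) x) := fun k m x =>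
    congrArg (fun T : K →L[ℂ] K => T x) (commBA'.pow_pow k m).eq
  -- With g = A*ᵐAʲκ and h = B*ᵏBⁿκ the Gram entry is ⟨g, h⟩. Evaluating ⟨Yg, Xh⟩ by eigenvalues
  -- gives t̄s⟨g, h⟩, and by the rank one identity ⟨g, κ⟩⟨κ, h⟩.
  refine ⟨(starRingEnd ℂ t * s)⁻¹, ?_, fun j k m n => ?_⟩
  · rw [mul_comm s t] at hst
    exact inv_ne_zero (mul_ne_zero ((map_ne_zero _).2 (left_ne_zero_of_mul hst))
      (right_ne_zero_of_mul hst))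
  set g := (adjoint A ^ m) ((A ^ j) κ) with hg
  set h := (adjoint B ^ k) ((B ^ n) κ) with hh
  have e1 : ⟪(A ^ j) ((B ^ k) κ), (A ^ m) ((B ^ n) κ)⟫_ℂ = ⟪g, h⟫_ℂ := by
    rw [← adj A, cAB, ← cBA', ← inner_conj_symm, ← adj B, inner_conj_symm]
  have e2 : ⟪g, κ⟫_ℂ = ⟪(A ^ j) κ, (A ^ m) κ⟫_ℂ := adj A m _ _
  have e3 : ⟪κ, h⟫_ℂ = ⟪(B ^ k) κ, (B ^ n) κ⟫_ℂ := by
    rw [← inner_conj_symm, adj B, inner_conj_symm]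
  have e4 : ⟪Y g, X h⟫_ℂ = starRingEnd ℂ t * s * ⟪g, h⟫_ℂ := by
    rw [hA'n m _ (hAn j _ ht), hB'n k _ (hBn n _ hs), inner_smul_left, inner_smul_right, mul_assoc]
  have e5 : ⟪Y g, X h⟫_ℂ = ⟪κ, h⟫_ℂ * ⟪g, κ⟫_ℂ := by
    rw [hYs, hYX, hXY, inner_smul_right]
  have hne : starRingEnd ℂ t * s ≠ 0 :=
    mul_ne_zero ((map_ne_zero _).2 (right_ne_zero_of_mul hst)) (left_ne_zero_of_mul hst)
  rw [e1, ← e2, ← e3, mul_comm ⟪g, κ⟫_ℂ, ← e5, e4, ← mul_assoc, inv_mul_cancel₀ hne, one_mul]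

end Abstract

open ContinuousLinearMap

/-! ### The defect identity on the bidisc -/

theorem adjoint_Mz_Mz (x : H2) : adjoint Mz (Mz x) = x :=
  ext_inner_left ℂ fun y => by rw [adjoint_inner_right, inner_Mz_Mz]

theorem adjoint_Mw_Mw (x : H2) : adjoint Mw (Mw x) = x :=
  ext_inner_left ℂ fun y => by rw [adjoint_inner_right, inner_Mw_Mw]

theorem adjoint_Mz_unitVec_zero (k : ℕ) : adjoint Mz (unitVec (0, k)) = 0 := by
  refine ext_inner_unitVec fun q => ?_
  rw [adjoint_inner_right, Mz_unitVec, inner_unitVec_left, unitVec_apply, inner_zero_right,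
    if_neg (by simp)]

theorem adjoint_Mw_unitVec_zero (j : ℕ) : adjoint Mw (unitVec (j, 0)) = 0 := by
  refine ext_inner_unitVec fun q => ?_
  rw [adjoint_inner_right, Mw_unitVec, inner_unitVec_left, unitVec_apply, inner_zero_right,
    if_neg (by simp)]

theorem adjoint_Mz_unitVec_succ (j k : ℕ) :
    adjoint Mz (unitVec (j + 1, k)) = unitVec (j, k) := by
  rw [← Mz_unitVec (j, k), adjoint_Mz_Mz]

theorem adjoint_Mw_unitVec_succ (j k : ℕ) :
    adjoint Mw (unitVec (j, k + 1)) = unitVec (j, k) := by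
  rw [← Mw_unitVec (j, k), adjoint_Mw_Mw]

theorem adjoint_Mz_Mw (x : H2) : adjoint Mz (Mw x) = Mw (adjoint Mz x) := by
  refine clm_ext_unitVec (A := adjoint Mz ∘L Mw) (B := Mw ∘L adjoint Mz) (fun p => ?_) x
  obtain ⟨j, k⟩ := p
  cases j <;>
    simp [adjoint_Mz_unitVec_zero, adjoint_Mz_unitVec_succ, Mw_unitVec]

/-- On a monomial, 1 - M_w M_w* kills positive powers of w and 1 - M_z M_z* positive powers of z, so
only the constant survives. -/
theorem bidisc_defect (x : H2) :
    (x - Mw (adjoint Mw x)) - Mz (adjoint Mz (x - Mw (adjoint Mw x))) =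
      ⟪(unitVec (0, 0) : H2), x⟫_ℂ • unitVec (0, 0) := by
  refine clm_ext_unitVec
    (A := (ContinuousLinearMap.id ℂ H2 - Mz ∘L adjoint Mz) ∘L
      (ContinuousLinearMap.id ℂ H2 - Mw ∘L adjoint Mw))
    (B := (innerSL ℂ (unitVec (0, 0) : H2)).smulRight (unitVec (0, 0))) (fun p => ?_) x
  obtain ⟨j, k⟩ := p
  have h0 : ‖(unitVec (0, 0) : H2)‖ = 1 := orthonormal_unitVec.1 _
  cases j <;> cases k <;>
    simp [h0, adjoint_Mz_unitVec_zero, adjoint_Mw_unitVec_zero, adjoint_Mz_unitVec_succ,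
      adjoint_Mw_unitVec_succ, Mz_unitVec, Mw_unitVec, inner_unitVec_left, unitVec_apply]

/-! ### Compressions to the quotient module -/

section Quotient

variable {S : Submodule ℂ H2}

/-- M_z maps S into S, so the component of x in S contributes nothing after projecting. -/
theorem proj_Mz (hS : IsHardySubmodule S) (x : H2) :
    Sᗮ.orthogonalProjectionOnto (Mz x) =
      compression Sᗮ Mz (Sᗮ.orthogonalProjectionOnto x) := by
  have : CompleteSpace S := hS.isClosed.completeSpace_coe
  have h1 : x - Sᗮ.orthogonalProjectionOnto x ∈ S := by
    have := Sᗮ.sub_starProjection_mem_orthogonal x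
    rwa [Submodule.orthogonal_orthogonal] at this
  have h2 : Sᗮ.orthogonalProjectionOnto (Mz (x - Sᗮ.orthogonalProjectionOnto x)) = 0 := by
    rw [Submodule.orthogonalProjectionOnto_eq_zero_iff, Submodule.orthogonal_orthogonal]
    exact hS.mz_mem _ h1
  rw [map_sub, map_sub, sub_eq_zero] at h2
  exact h2

theorem proj_Mw (hS : IsHardySubmodule S) (x : H2) :
    Sᗮ.orthogonalProjectionOnto (Mw x) =
      compression Sᗮ Mw (Sᗮ.orthogonalProjectionOnto x) := by
  have : CompleteSpace S := hS.isClosed.completeSpace_coe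
  have h1 : x - Sᗮ.orthogonalProjectionOnto x ∈ S := by
    have := Sᗮ.sub_starProjection_mem_orthogonal x
    rwa [Submodule.orthogonal_orthogonal] at this
  have h2 : Sᗮ.orthogonalProjectionOnto (Mw (x - Sᗮ.orthogonalProjectionOnto x)) = 0 := by
    rw [Submodule.orthogonalProjectionOnto_eq_zero_iff, Submodule.orthogonal_orthogonal]
    exact hS.mw_mem _ h1
  rw [map_sub, map_sub, sub_eq_zero] at h2
  exact h2

theorem inner_proj (x : H2) (q : Sᗮ) :
    ⟪Sᗮ.orthogonalProjectionOnto x, q⟫_ℂ = ⟪x, (q : H2)⟫_ℂ :=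
  Submodule.inner_orthogonalProjectionOnto_eq_of_mem_right q x

/-- The adjoint form of the intertwining relation: Sᗮ is invariant under A*, and the adjoint of the
compression is the restriction of A*. -/
theorem coe_adjoint_compression {A : H2 →L[ℂ] H2}
    (hA : ∀ x, Sᗮ.orthogonalProjectionOnto (A x) =
      compression Sᗮ A (Sᗮ.orthogonalProjectionOnto x)) (q : Sᗮ) :
    (adjoint (compression Sᗮ A) q : H2) = adjoint A q := by
  refine ext_inner_left ℂ fun x => ?_
  rw [← inner_proj, adjoint_inner_right, ← hA, inner_proj, adjoint_inner_right]

theorem proj_monoMul (hS : IsHardySubmodule S) (p : ℕ × ℕ) (x : H2) :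
    Sᗮ.orthogonalProjectionOnto (monoMul p x) = (compression Sᗮ Mz ^ p.1)
      ((compression Sᗮ Mw ^ p.2) (Sᗮ.orthogonalProjectionOnto x)) := by
  have hz : ∀ n x, Sᗮ.orthogonalProjectionOnto ((Mz ^ n) x) =
      (compression Sᗮ Mz ^ n) (Sᗮ.orthogonalProjectionOnto x) := by
    intro n
    induction n with
    | zero => exact fun x => rfl
    | succ n ih =>
      intro x
      rw [pow_succ', mul_apply_eq_comp, proj_Mz hS, ih, pow_succ', mul_apply_eq_comp]
  have hw : ∀ n x, Sᗮ.orthogonalProjectionOnto ((Mw ^ n) x) =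
      (compression Sᗮ Mw ^ n) (Sᗮ.orthogonalProjectionOnto x) := by
    intro n
    induction n with
    | zero => exact fun x => rfl
    | succ n ih =>
      intro x
      rw [pow_succ', mul_apply_eq_comp, proj_Mw hS, ih, pow_succ', mul_apply_eq_comp]
  rw [monoMul, mul_apply_eq_comp, hz, hw]

theorem proj_coe (q : Sᗮ) : Sᗮ.orthogonalProjectionOnto (q : H2) = q :=
  Submodule.orthogonalProjectionOnto_mem_subspace_eq_self q

theorem compression_comm (hS : IsHardySubmodule S) (x : Sᗮ) :
    compression Sᗮ Mz (compression Sᗮ Mw x) = compression Sᗮ Mw (compression Sᗮ Mz x) := by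
  rw [← proj_coe x, ← proj_Mw hS, ← proj_Mz hS, ← proj_Mz hS, ← proj_Mw hS, Mz_Mw]

theorem compression_comp_adjoint {A : H2 →L[ℂ] H2}
    (hA : ∀ x, Sᗮ.orthogonalProjectionOnto (A x) =
      compression Sᗮ A (Sᗮ.orthogonalProjectionOnto x)) (q : Sᗮ) :
    compression Sᗮ A (adjoint (compression Sᗮ A) q) =
      Sᗮ.orthogonalProjectionOnto (A (adjoint A (q : H2))) := by
  rw [hA, ← coe_adjoint_compression hA, proj_coe]

/-- `P_Q 1`, where `Q = Sᗮ` -/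
def projOne (S : Submodule ℂ H2) : Sᗮ := Sᗮ.orthogonalProjectionOnto (unitVec (0, 0))

/-- The identity `bidisc_defect` is projected to Sᗮ. Only the mixed term needs double commutativity:
C_z C_z* C_w C_w* has to be reordered to C_z C_w C_z* C_w*, where the adjoints are restrictions and
the remaining factors lift to M_z M_w. -/
theorem compression_defect (hS : IsCoDoublyCommuting S) (x : Sᗮ) :
    (x - compression Sᗮ Mw (adjoint (compression Sᗮ Mw) x)) -
      compression Sᗮ Mz (adjoint (compression Sᗮ Mz)
        (x - compression Sᗮ Mw (adjoint (compression Sᗮ Mw) x))) =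
      ⟪projOne S, x⟫_ℂ • projOne S := by
  have hH := hS.toIsHardySubmodule
  have hc : ∀ x, compression Sᗮ Mz (adjoint (compression Sᗮ Mw) x) =
      adjoint (compression Sᗮ Mw) (compression Sᗮ Mz x) := fun x =>
    congrArg (fun T : Sᗮ →L[ℂ] Sᗮ => T x) hS.doublyCommuting
  have h1 : compression Sᗮ Mz (adjoint (compression Sᗮ Mz)
      (compression Sᗮ Mw (adjoint (compression Sᗮ Mw) x))) =
      Sᗮ.orthogonalProjectionOnto (Mz (adjoint Mz (Mw (adjoint Mw (x : H2))))) := by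
    rw [← adjoint_comm hc, adjoint_Mz_Mw, proj_Mz hH, proj_Mw hH,
      ← coe_adjoint_compression (proj_Mw hH), ← coe_adjoint_compression (proj_Mz hH), proj_coe]
  have h2 := congrArg Sᗮ.orthogonalProjectionOnto (bidisc_defect (x : H2))
  rw [map_sub, map_sub, map_sub, map_sub, map_sub, proj_coe,
    ← compression_comp_adjoint (proj_Mz hH), ← compression_comp_adjoint (proj_Mw hH), ← h1,
    map_smul, ← inner_proj] at h2
  rw [map_sub, map_sub]
  exact h2

theorem proj_unitVec (hS : IsHardySubmodule S) (m n : ℕ) :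
    Sᗮ.orthogonalProjectionOnto (unitVec (m, n)) =
      (compression Sᗮ Mz ^ m) ((compression Sᗮ Mw ^ n) (projOne S)) := by
  rw [projOne, ← proj_monoMul hS (m, n), monoMul_unitVec]
  rfl

/-- Otherwise 1 ∈ S, and then every monomial is in S. -/
theorem projOne_ne_zero (hS : IsHardySubmodule S) (hne : S ≠ ⊤) : projOne S ≠ 0 := by
  have : CompleteSpace S := hS.isClosed.completeSpace_coe
  intro h0
  refine hne (Submodule.eq_top_iff'.2 (mem_of_unitVec_mem hS.isClosed fun p => ?_))
  rw [projOne, Submodule.orthogonalProjectionOnto_eq_zero_iff,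
    Submodule.orthogonal_orthogonal] at h0
  have h2 := monoMul_mem hS h0 p
  rw [monoMul_unitVec] at h2
  exact h2

theorem gram_proj_unitVec (hS : IsCoDoublyCommuting S) (hne : S ≠ ⊤) :
    ∃ c : ℂ, c ≠ 0 ∧ ∀ j k m n : ℕ,
      (Sᗮ.orthogonalProjectionOnto (unitVec (m, n)) : H2) (j, k) =
      c * (⟪(compression Sᗮ Mz ^ j) (projOne S), (compression Sᗮ Mz ^ m) (projOne S)⟫_ℂ *
        ⟪(compression Sᗮ Mw ^ k) (projOne S), (compression Sᗮ Mw ^ n) (projOne S)⟫_ℂ) := by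
  have hH := hS.toIsHardySubmodule
  have hc : ∀ x, compression Sᗮ Mz (adjoint (compression Sᗮ Mw) x) =
      adjoint (compression Sᗮ Mw) (compression Sᗮ Mz x) := fun x =>
    congrArg (fun T : Sᗮ →L[ℂ] Sᗮ => T x) hS.doublyCommuting
  obtain ⟨c, hc0, hgram⟩ := exists_gram_factorization (compression_comm hH) hc
    (projOne_ne_zero hH hne) (compression_defect hS)
  refine ⟨c, hc0, fun j k m n => ?_⟩
  rw [← hgram, ← proj_unitVec hH, ← proj_unitVec hH, inner_proj, inner_unitVec_left]

theorem adjoint_tenRight_apply (hS : IsHardySubmodule S) (j : ℕ) (q : Sᗮ) :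
    adjoint (tenRight (unitVec 0)) (q : H2) j = ⟪(compression Sᗮ Mz ^ j) (projOne S), q⟫_ℂ := by
  rw [← inner_unitVec_left, adjoint_inner_right, tenRight_apply, ten_unitVec, ← inner_proj,
    proj_unitVec hS, pow_zero]
  rfl

theorem adjoint_tenLeft_apply (hS : IsHardySubmodule S) (k : ℕ) (q : Sᗮ) :
    adjoint (tenLeft (unitVec 0)) (q : H2) k = ⟪(compression Sᗮ Mw ^ k) (projOne S), q⟫_ℂ := by
  rw [← inner_unitVec_left, adjoint_inner_right, tenLeft_apply, ten_unitVec, ← inner_proj,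
    proj_unitVec hS, pow_zero]
  rfl

/-- The projection onto the quotient module `Sᗮ` takes monomials to elementary tensors. -/
def IsTensorQuotient (S : Submodule ℂ H2) (p r : ℕ → H1) : Prop :=
  (∀ m n, (Sᗮ.orthogonalProjectionOnto (unitVec (m, n)) : H2) = ten (p m) (r n)) ∧
    p 0 0 ≠ 0 ∧ r 0 0 ≠ 0

theorem exists_isTensorQuotient (hS : IsCoDoublyCommuting S) (hne : S ≠ ⊤) :
    ∃ p r, IsTensorQuotient S p r := by
  have hH := hS.toIsHardySubmodule
  obtain ⟨c, hc, hgram⟩ := gram_proj_unitVec hS hne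
  have h0 : ⟪projOne S, projOne S⟫_ℂ ≠ 0 := inner_self_ne_zero.2 (projOne_ne_zero hH hne)
  -- The adjoint of a ↦ a ⊗ 1 is the restriction F ↦ F(z, 0). Thus p_m(z) = (P_Q z^m)(z, 0) and
  -- r_n(w) = c (P_Q w^n)(0, w), with c the constant of the Gram factorization.
  refine ⟨fun m => adjoint (tenRight (unitVec 0)) ((compression Sᗮ Mz ^ m) (projOne S) : Sᗮ),
    fun n => c • adjoint (tenLeft (unitVec 0)) ((compression Sᗮ Mw ^ n) (projOne S) : Sᗮ),
    fun m n => ?_, ?_, ?_⟩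
  · ext ⟨j, k⟩
    rw [hgram, ten_apply, lp.coeFn_smul, Pi.smul_apply, adjoint_tenRight_apply hH,
      adjoint_tenLeft_apply hH, smul_eq_mul]
    ring
  · rw [adjoint_tenRight_apply hH]
    exact h0
  · rw [lp.coeFn_smul, Pi.smul_apply, adjoint_tenLeft_apply hH, smul_eq_mul]
    exact mul_ne_zero hc h0

/-! ### Slices of the submodule -/

/-- The functions of `z` alone in `S`. -/
def sliceZ (S : Submodule ℂ H2) : Submodule ℂ H1 := S.comap (tenRight (unitVec 0)).toLinearMap

/-- The functions of `w` alone in `S`. -/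
def sliceW (S : Submodule ℂ H2) : Submodule ℂ H1 := S.comap (tenLeft (unitVec 0)).toLinearMap

theorem mem_sliceZ {a : H1} : a ∈ sliceZ S ↔ ten a (unitVec 0) ∈ S := Iff.rfl

theorem mem_sliceW {b : H1} : b ∈ sliceW S ↔ ten (unitVec 0) b ∈ S := Iff.rfl

theorem isClosed_sliceZ (hS : IsHardySubmodule S) : IsClosed (sliceZ S : Set H1) :=
  hS.isClosed.preimage (tenRight (unitVec 0)).continuous

theorem isClosed_sliceW (hS : IsHardySubmodule S) : IsClosed (sliceW S : Set H1) :=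
  hS.isClosed.preimage (tenLeft (unitVec 0)).continuous

theorem shift_mem_sliceZ (hS : IsHardySubmodule S) (a : H1) (ha : a ∈ sliceZ S) :
    unilateralShift a ∈ sliceZ S := by
  rw [mem_sliceZ, ← Mz_ten]
  exact hS.mz_mem _ ha

theorem shift_mem_sliceW (hS : IsHardySubmodule S) (b : H1) (hb : b ∈ sliceW S) :
    unilateralShift b ∈ sliceW S := by
  rw [mem_sliceW, ← Mw_ten]
  exact hS.mw_mem _ hb

theorem ten_mem_of_mem_sliceZ (hS : IsHardySubmodule S) {a : H1} (ha : a ∈ sliceZ S) (b : H1) :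
    ten a b ∈ S := by
  refine mem_of_unitVec_mem (K := S.comap (tenLeft a).toLinearMap)
    (hS.isClosed.preimage (tenLeft a).continuous) (fun k => ?_) b
  have h1 := monoMul_mem hS (mem_sliceZ.1 ha) (0, k)
  rwa [monoMul_ten, shiftPow_unitVec] at h1

theorem ten_mem_of_mem_sliceW (hS : IsHardySubmodule S) (a : H1) {b : H1} (hb : b ∈ sliceW S) :
    ten a b ∈ S := by
  refine mem_of_unitVec_mem (K := S.comap (tenRight b).toLinearMap)
    (hS.isClosed.preimage (tenRight b).continuous) (fun k => ?_) a
  have h1 := monoMul_mem hS (mem_sliceW.1 hb) (k, 0)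
  rwa [monoMul_ten, shiftPow_unitVec] at h1

variable {p r : ℕ → H1}

theorem IsTensorQuotient.mem_iff (h : IsTensorQuotient S p r) (hS : IsHardySubmodule S) (x : H2) :
    x ∈ S ↔ ∀ m n, ⟪ten (p m) (r n), x⟫_ℂ = 0 := by
  have : CompleteSpace S := hS.isClosed.completeSpace_coe
  constructor
  · intro hx m n
    rw [← h.1]
    exact (Submodule.mem_orthogonal' _ _).1 (Subtype.mem _) x hx
  · intro hx
    have h0 : Sᗮ.orthogonalProjectionOnto x = 0 := by
      refine Subtype.ext (ext_inner_unitVec fun q => ?_)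
      rw [← inner_proj, ← inner_conj_symm, inner_proj, ← Prod.mk.eta (p := q), inner_conj_symm,
        Submodule.coe_zero, inner_zero_right, ← hx q.1 q.2, ← h.1]
    rwa [Submodule.orthogonalProjectionOnto_eq_zero_iff, Submodule.orthogonal_orthogonal] at h0

/-- The condition ⟨p_m, a⟩⟨r_n, 1⟩ = 0 at n = 0 gives ⟨p_m, a⟩ = 0, because r_0 has nonzero constant
coefficient. -/
theorem IsTensorQuotient.mem_sliceZ_iff (h : IsTensorQuotient S p r) (hS : IsHardySubmodule S)
    (a : H1) : a ∈ sliceZ S ↔ ∀ m, ⟪p m, a⟫_ℂ = 0 := by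
  rw [mem_sliceZ, h.mem_iff hS]
  simp only [inner_ten]
  refine ⟨fun ha m => (mul_eq_zero.1 (ha m 0)).resolve_right fun h0 => h.2.2 ?_,
    fun ha m n => by rw [ha, zero_mul]⟩
  rw [← inner_unitVec_left, inner_eq_zero_symm.1 h0]

theorem IsTensorQuotient.mem_sliceW_iff (h : IsTensorQuotient S p r) (hS : IsHardySubmodule S)
    (b : H1) : b ∈ sliceW S ↔ ∀ n, ⟪r n, b⟫_ℂ = 0 := by
  rw [mem_sliceW, h.mem_iff hS]
  simp only [inner_ten]
  refine ⟨fun hb n => (mul_eq_zero.1 (hb 0 n)).resolve_left fun h0 => h.2.1 ?_,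
    fun hb m n => by rw [hb, mul_zero]⟩
  rw [← inner_unitVec_left, inner_eq_zero_symm.1 h0]

/-- `S` contains the orthogonal complement of the tensor product of the complements of its
slices. -/
theorem IsTensorQuotient.mem_of_inner_eq_zero (h : IsTensorQuotient S p r)
    (hS : IsHardySubmodule S) {x : H2}
    (hx : ∀ a ∈ (sliceZ S)ᗮ, ∀ b ∈ (sliceW S)ᗮ, ⟪ten a b, x⟫_ℂ = 0) : x ∈ S :=
  (h.mem_iff hS x).2 fun m n => hx _
    ((Submodule.mem_orthogonal' _ _).2 fun a ha => (h.mem_sliceZ_iff hS a).1 ha m) _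
    ((Submodule.mem_orthogonal' _ _).2 fun b hb => (h.mem_sliceW_iff hS b).1 hb n)

/-- One variable at a time: pairing x with r_n in w leaves a function orthogonal to every p_m, hence
in the z-slice and orthogonal to a. The same argument in w replaces r_n by b. -/
theorem IsTensorQuotient.inner_eq_zero (h : IsTensorQuotient S p r)
    (hS : IsHardySubmodule S) {x : H2} (hx : x ∈ S) {a b : H1} (ha : a ∈ (sliceZ S)ᗮ)
    (hb : b ∈ (sliceW S)ᗮ) : ⟪ten a b, x⟫_ℂ = 0 := by
  have h1 : ∀ n, ⟪ten a (r n), x⟫_ℂ = 0 := fun n => by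
    rw [← tenRight_apply, ← adjoint_inner_right]
    refine (Submodule.mem_orthogonal' _ _).1 ha _ ((h.mem_sliceZ_iff hS _).2 fun m => ?_)
    rw [adjoint_inner_right]
    exact (h.mem_iff hS x).1 hx m n
  rw [← tenLeft_apply, ← adjoint_inner_right]
  refine (Submodule.mem_orthogonal' _ _).1 hb _ ((h.mem_sliceW_iff hS _).2 fun n => ?_)
  rw [adjoint_inner_right]
  exact h1 n

/-- The quotient module is the tensor product of the complements of the slices. -/
theorem IsTensorQuotient.mem_orthogonal (h : IsTensorQuotient S p r)
    (hS : IsHardySubmodule S) {x : H2} (hz : ∀ a ∈ sliceZ S, ∀ b, ⟪ten a b, x⟫_ℂ = 0)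
    (hw : ∀ a, ∀ b ∈ sliceW S, ⟪ten a b, x⟫_ℂ = 0) : x ∈ Sᗮ := by
  have : CompleteSpace S := hS.isClosed.completeSpace_coe
  have : CompleteSpace (sliceZ S) := (isClosed_sliceZ hS).completeSpace_coe
  have : CompleteSpace (sliceW S) := (isClosed_sliceW hS).completeSpace_coe
  set y := S.starProjection x with hy
  have hyS : y ∈ S := S.starProjection_apply_mem x
  have hxy : ∀ u ∈ S, ⟪u, x⟫_ℂ = ⟪u, y⟫_ℂ := fun u hu => by
    have := (Submodule.mem_orthogonal _ _).1 (S.sub_starProjection_mem_orthogonal x) u hu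
    rwa [inner_sub_right, sub_eq_zero] at this
  -- Split both factors of a monomial along the slices and their complements. Terms with a factor in
  -- a slice lie in S, where y may be replaced by x; the remaining term is orthogonal to S.
  have hy0 : y = 0 := by
    refine ext_inner_unitVec fun q => ?_
    rw [← Prod.mk.eta (p := q), ← ten_unitVec, inner_zero_right]
    generalize (unitVec q.1 : H1) = a
    generalize (unitVec q.2 : H1) = b
    have ha1 : ⟪ten ((sliceZ S).starProjection a) b, y⟫_ℂ = 0 := by
      rw [← hxy _ (ten_mem_of_mem_sliceZ hS ((sliceZ S).starProjection_apply_mem a) b)]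
      exact hz _ ((sliceZ S).starProjection_apply_mem a) b
    have hb1 : ∀ a, ⟪ten a ((sliceW S).starProjection b), y⟫_ℂ = 0 := fun a => by
      rw [← hxy _ (ten_mem_of_mem_sliceW hS a ((sliceW S).starProjection_apply_mem b))]
      exact hw a _ ((sliceW S).starProjection_apply_mem b)
    have hab := h.inner_eq_zero hS hyS ((sliceZ S).sub_starProjection_mem_orthogonal a)
      ((sliceW S).sub_starProjection_mem_orthogonal b)
    rw [← add_sub_cancel ((sliceZ S).starProjection a) a, ten_add_left, inner_add_left, ha1,
      zero_add]
    generalize a - (sliceZ S).starProjection a = a' at *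
    rw [← add_sub_cancel ((sliceW S).starProjection b) b, ten_add_right, inner_add_left, hb1,
      zero_add, hab]
  rw [Submodule.mem_orthogonal]
  intro u hu
  rw [hxy u hu, hy0, inner_zero_right]

end Quotient

/-! ### A Hankel operator with unimodular symbol -/

theorem adjoint_monoMul_ten (p : ℕ × ℕ) (a b : H1) :
    adjoint (monoMul p) (ten a b) = ten (adjoint (shiftPow p.1).toContinuousLinearMap a)
      (adjoint (shiftPow p.2).toContinuousLinearMap b) := by
  refine ext_inner_unitVec fun q => ?_
  rw [adjoint_inner_right, ← Prod.mk.eta (p := q), ← ten_unitVec, monoMul_ten, inner_ten,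
    inner_ten, adjoint_inner_right, adjoint_inner_right]
  rfl

theorem adjoint_mulTen_ten {φ₁ φ₂ : H1} (h₁ : IsIsometricMultiplier φ₁)
    (h₂ : IsIsometricMultiplier φ₂) (a b : H1) :
    adjoint (mulTen h₁ h₂).toContinuousLinearMap (ten a b) =
      ten (adjoint (mulOp φ₁ h₁).toContinuousLinearMap a)
        (adjoint (mulOp φ₂ h₂).toContinuousLinearMap b) := by
  refine ext_inner_unitVec fun q => ?_
  rw [adjoint_inner_right, ← Prod.mk.eta (p := q), ← ten_unitVec, inner_ten,
    adjoint_inner_right, adjoint_inner_right, ← inner_ten]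
  exact congrArg (fun x => ⟪x, ten a b⟫_ℂ) (mulTen_ten h₁ h₂ _ _)

theorem adjoint_mulOp_one (x : H1) :
    adjoint (mulOp _ isIsometricMultiplier_unitVec_zero).toContinuousLinearMap x = x :=
  ext_inner_left ℂ fun y => by
    rw [adjoint_inner_right]
    exact congrArg (fun y => ⟪y, x⟫_ℂ) (mulOp_one y)

theorem adjoint_shiftPow_succ_unitVec_zero (n : ℕ) :
    adjoint (shiftPow (n + 1)).toContinuousLinearMap (unitVec 0) = 0 := by
  refine ext_inner_unitVec fun m => ?_
  rw [adjoint_inner_right, inner_zero_right]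
  change ⟪shiftPow (n + 1) (unitVec m), unitVec 0⟫_ℂ = 0
  rw [shiftPow_unitVec, inner_unitVec_left, unitVec_apply, if_neg (by omega)]

section Hankel

variable {φ₁ φ₂ : H1}

/-- With N above all indices in s, multiplying both sides of the inner product by the monomial of
exponent N - p turns the p-th term into the pairing of one fixed vector, of norm ‖y‖, with an
element of an orthonormal family. Bessel's inequality concludes. -/
theorem sum_inner_monoMul_le (h₁ : IsIsometricMultiplier φ₁) (h₂ : IsIsometricMultiplier φ₂)
    (y : H2) (s : Finset (ℕ × ℕ)) :
    ∑ p ∈ s, ‖⟪monoMul (p + (1, 1)) y, ten φ₁ φ₂⟫_ℂ‖ ^ 2 ≤ ‖y‖ ^ 2 := by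
  obtain ⟨N, hN⟩ : ∃ N : ℕ × ℕ, ∀ p ∈ s, p ≤ N := s.exists_le
  have hv := orthonormal_ten_shiftPow h₁ h₂
  have h := hv.sum_inner_products_le (monoMul (N + (1, 1)) y) (s := s.image fun p => N - p)
  rw [norm_monoMul, Finset.sum_image] at h
  · refine le_trans (le_of_eq (Finset.sum_congr rfl fun p hp => ?_)) h
    congr 1
    rw [norm_inner_symm, ← inner_monoMul (N - p), ← monoMul_add, ← add_assoc,
      tsub_add_cancel_of_le (hN p hp), monoMul_ten]
  · intro p hp q hq hpq
    have h1 := tsub_add_cancel_of_le (hN p hp)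
    have h2 := tsub_add_cancel_of_le (hN q hq)
    simp only at hpq
    rw [hpq] at h1
    exact add_left_cancel (h1.trans h2.symm)

/-- The conjugate linear Hankel operator `y ↦ P (z̄ w̄ φ₁(z) φ₂(w) ȳ)` -/
def hankel (h₁ : IsIsometricMultiplier φ₁) (h₂ : IsIsometricMultiplier φ₂) : H2 →L⋆[ℂ] H2 :=
  LinearMap.mkContinuous
    { toFun := fun y => ⟨fun p => ⟪monoMul (p + (1, 1)) y, ten φ₁ φ₂⟫_ℂ,
        memℓp_gen' (C := ‖y‖ ^ 2) fun s => by
          simpa using sum_inner_monoMul_le h₁ h₂ y s⟩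
      map_add' := fun x y => by
        ext p
        exact (congrArg (fun u => ⟪u, ten φ₁ φ₂⟫_ℂ) (map_add _ x y)).trans (inner_add_left _ _ _)
      map_smul' := fun c x => by
        ext p
        exact (congrArg (fun u => ⟪u, ten φ₁ φ₂⟫_ℂ) (map_smul _ c x)).trans
          (inner_smul_left _ _ _) } 1
    fun y => by
      rw [one_mul]
      refine lp.norm_le_of_forall_sum_le (by norm_num) (norm_nonneg y) fun s => ?_
      simpa using sum_inner_monoMul_le h₁ h₂ y s

variable (h₁ : IsIsometricMultiplier φ₁) (h₂ : IsIsometricMultiplier φ₂)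

theorem hankel_apply (y : H2) (p : ℕ × ℕ) :
    hankel h₁ h₂ y p = ⟪monoMul (p + (1, 1)) y, ten φ₁ φ₂⟫_ℂ := rfl

/-- The matrix entry at (i, j) depends only on i + j. Both sides are conjugate linear in x and in y,
so monomials suffice. -/
theorem inner_hankel_comm (x y : H2) : ⟪x, hankel h₁ h₂ y⟫_ℂ = ⟪y, hankel h₁ h₂ x⟫_ℂ := by
  refine unitVec_induction (p := fun y => ⟪x, hankel h₁ h₂ y⟫_ℂ = ⟪y, hankel h₁ h₂ x⟫_ℂ) y
    (fun i => ?_) (by simp) (fun y y' hy hy' => ?_) (fun c y hy => ?_)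
    (isClosed_eq (by fun_prop) (by fun_prop))
  · refine unitVec_induction
      (p := fun x => ⟪x, hankel h₁ h₂ (unitVec i)⟫_ℂ = ⟪unitVec i, hankel h₁ h₂ x⟫_ℂ) x
      (fun j => ?_) (by simp) (fun y y' hy hy' => ?_) (fun c y hy => ?_)
      (isClosed_eq (by fun_prop) (by fun_prop))
    · rw [inner_unitVec_left, inner_unitVec_left, hankel_apply, hankel_apply, monoMul_unitVec,
        monoMul_unitVec, add_right_comm, add_comm j i, add_right_comm]
    · rw [inner_add_left, map_add, inner_add_right, hy, hy']
    · rw [inner_smul_left, map_smulₛₗ, inner_smul_right, hy]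
  · rw [inner_add_left, map_add, inner_add_right, hy, hy']
  · rw [inner_smul_left, map_smulₛₗ, inner_smul_right, hy]

theorem hankel_monoMul (p : ℕ × ℕ) (x : H2) :
    hankel h₁ h₂ (monoMul p x) = adjoint (monoMul p) (hankel h₁ h₂ x) := by
  refine ext_inner_unitVec fun q => ?_
  rw [adjoint_inner_right, monoMul_unitVec, inner_unitVec_left, inner_unitVec_left, hankel_apply,
    hankel_apply, ← monoMul_add, add_right_comm, add_comm p q]

theorem inner_monoMul_hankel (p : ℕ × ℕ) (x y : H2) :
    ⟪monoMul p x, hankel h₁ h₂ y⟫_ℂ = ⟪monoMul p y, hankel h₁ h₂ x⟫_ℂ := by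
  rw [inner_hankel_comm, hankel_monoMul, adjoint_inner_right]

/-- The factor φ₁ cancels from both sides of the inner product, leaving z^{j+1}w^{k+1}x against 1 ⊗
φ₂, which has no positive power of z. -/
theorem hankel_mulTen_left (x : H2) :
    hankel h₁ h₂ (mulTen h₁ isIsometricMultiplier_unitVec_zero x) = 0 := by
  refine ext_inner_unitVec fun q => ?_
  have h : ten φ₁ φ₂ =
      mulTen h₁ isIsometricMultiplier_unitVec_zero (ten (unitVec 0) φ₂) := by
    rw [mulTen_ten, mulOp_one, mulOp_unitVec_zero]
  rw [inner_unitVec_left, hankel_apply, ← mulTen_monoMul, h, LinearIsometry.inner_map_map,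
    ← adjoint_inner_right, adjoint_monoMul_ten, Prod.fst_add, adjoint_shiftPow_succ_unitVec_zero,
    ← tenRight_apply, map_zero, inner_zero_right, inner_zero_right]

theorem hankel_mulTen_right (x : H2) :
    hankel h₁ h₂ (mulTen isIsometricMultiplier_unitVec_zero h₂ x) = 0 := by
  refine ext_inner_unitVec fun q => ?_
  have h : ten φ₁ φ₂ =
      mulTen isIsometricMultiplier_unitVec_zero h₂ (ten φ₁ (unitVec 0)) := by
    rw [mulTen_ten, mulOp_one, mulOp_unitVec_zero]
  rw [inner_unitVec_left, hankel_apply, ← mulTen_monoMul, h, LinearIsometry.inner_map_map,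
    ← adjoint_inner_right, adjoint_monoMul_ten, Prod.snd_add, adjoint_shiftPow_succ_unitVec_zero,
    ← tenLeft_apply, map_zero, inner_zero_right, inner_zero_right]

/-- The coefficients of the Hankel image are conjugates of the pairings of x with tensors of
backward shifts of φ₁ and φ₂. By `mem_range_mulOp`, applied in each variable, their vanishing makes
x orthogonal to the tensor product of the slice complements. -/
theorem mem_of_hankel_eq_zero {S : Submodule ℂ H2} (hS : IsHardySubmodule S) {p r : ℕ → H1}
    (h : IsTensorQuotient S p r) (hφ₁ : φ₁ ∈ sliceZ S) (hφ₂ : φ₂ ∈ sliceW S) {x : H2}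
    (hx : hankel h₁ h₂ x = 0) : x ∈ S := by
  have h0 : ∀ j k, ⟪ten (adjoint (shiftPow (j + 1)).toContinuousLinearMap φ₁)
      (adjoint (shiftPow (k + 1)).toContinuousLinearMap φ₂), x⟫_ℂ = 0 := by
    intro j k
    have h1 : hankel h₁ h₂ x (j, k) = 0 := by rw [hx]; rfl
    rw [hankel_apply, inner_eq_zero_symm, ← adjoint_inner_left, adjoint_monoMul_ten] at h1
    exact h1
  refine h.mem_of_inner_eq_zero hS fun a ha b hb => ?_
  have h1 : ∀ k, ⟪ten a (adjoint (shiftPow (k + 1)).toContinuousLinearMap φ₂), x⟫_ℂ = 0 := by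
    intro k
    rw [← tenRight_apply, ← adjoint_inner_right]
    obtain ⟨y, hy⟩ := mem_range_mulOp h₁ (x := adjoint (tenRight
      (adjoint (shiftPow (k + 1)).toContinuousLinearMap φ₂)) x) (fun j => by
        have := h0 j k
        rw [← tenRight_apply, ← adjoint_inner_right, adjoint_inner_left] at this
        exact this)
    rw [← hy]
    exact (Submodule.mem_orthogonal' _ _).1 ha _
      (range_mulOp_le (isClosed_sliceZ hS) (shift_mem_sliceZ hS) h₁ hφ₁ y)
  rw [← tenLeft_apply, ← adjoint_inner_right]
  obtain ⟨y, hy⟩ := mem_range_mulOp h₂ (x := adjoint (tenLeft a) x) (fun k => by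
    have := h1 k
    rw [← tenLeft_apply, ← adjoint_inner_right, adjoint_inner_left] at this
    exact this)
  rw [← hy]
  exact (Submodule.mem_orthogonal' _ _).1 hb _
    (range_mulOp_le (isClosed_sliceW hS) (shift_mem_sliceW hS) h₂ hφ₂ y)

end Hankel

/-! ### Submodules with two nontrivial slices are not cyclic -/

/-- In the application V and W are multiplication by φ₁(z) and φ₂(w), and U is the Hankel operator.
The hypotheses on U give V*U = W*U = 0, which removes all cross terms. -/
theorem exists_orthogonal_orbit {S : Submodule ℂ H2} (hne : S ≠ ⊤) (hcl : IsClosed (S : Set H2))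
    (V W : H2 →L[ℂ] H2) (U : H2 →L⋆[ℂ] H2) {f a b : H2}
    (hV : ∀ x y, ⟪V x, V y⟫_ℂ = ⟪x, y⟫_ℂ) (hW : ∀ x y, ⟪W x, W y⟫_ℂ = ⟪x, y⟫_ℂ)
    (hVm : ∀ p x, V (monoMul p x) = monoMul p (V x))
    (hWm : ∀ p x, W (monoMul p x) = monoMul p (W x))
    (hVW : ∀ x, adjoint V (W x) = W (adjoint V x))
    (hVS : ∀ x, V x ∈ S) (hWS : ∀ x, W x ∈ S) (hS : ∀ p, ∀ x ∈ S, monoMul p x ∈ S)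
    (hUs : ∀ x y, ⟪x, U y⟫_ℂ = ⟪y, U x⟫_ℂ)
    (hUm : ∀ p x y, ⟪monoMul p x, U y⟫_ℂ = ⟪monoMul p y, U x⟫_ℂ)
    (hUV : ∀ x, U (V x) = 0) (hUW : ∀ x, U (W x) = 0) (hU0 : ∀ x, U x = 0 → x ∈ S)
    (hf : f = V a + W b) : ∃ v ∈ S, v ≠ 0 ∧ ∀ p, ⟪monoMul p f, v⟫_ℂ = 0 := by
  have hWV : ∀ x, adjoint W (V x) = V (adjoint W x) := fun x => (adjoint_comm (A := W) (B := V)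
    (fun x => (hVW x).symm) x).symm
  have hVU : ∀ x, adjoint V (U x) = 0 := fun x => ext_inner_left ℂ fun y => by
    rw [adjoint_inner_right, hUs, hUV, inner_zero_right, inner_zero_right]
  have hWU : ∀ x, adjoint W (U x) = 0 := fun x => ext_inner_left ℂ fun y => by
    rw [adjoint_inner_right, hUs, hUW, inner_zero_right, inner_zero_right]
  by_contra! hcon
  -- Pairing this vector with the p-th monomial multiple of f leaves ⟨z^p a, Ub⟩ - ⟨z^p b, Ua⟩,
  -- which vanishes by the symmetry `hUm`.
  have hv : V (U b) - W (U a) = 0 := by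
    by_contra h0
    obtain ⟨p, hp⟩ := hcon _ (S.sub_mem (hVS _) (hWS _)) h0
    apply hp
    have e1 : ⟪monoMul p (W b), V (U b)⟫_ℂ = 0 := by
      rw [← hWm, ← adjoint_inner_right, hWV, hWU, map_zero, inner_zero_right]
    have e2 : ⟪monoMul p (V a), W (U a)⟫_ℂ = 0 := by
      rw [← hVm, ← adjoint_inner_right, hVW, hVU, map_zero, inner_zero_right]
    rw [hf, map_add, inner_sub_right, inner_add_left, inner_add_left, e1, e2, ← hVm, ← hWm, hV, hW,
      hUm p a b]
    ring
  -- The ranges of V ∘ U and W ∘ U are orthogonal, so V(Ub) = W(Ua) forces both to vanish.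
  have hUb : U b = 0 := by
    refine ext_inner_left ℂ fun y => ?_
    rw [← hV, sub_eq_zero.1 hv, ← adjoint_inner_right, hVW, hVU, map_zero]
  have hUa : U a = 0 := by
    refine ext_inner_left ℂ fun y => ?_
    rw [← hW, ← sub_eq_zero.1 hv, hUb, map_zero, inner_zero_right, inner_zero_right]
  have : CompleteSpace S := hcl.completeSpace_coe
  -- Now a ∈ S. For q ∈ Sᗮ the vector Vq is orthogonal to W(z^p b) since W*q = 0, and to V(z^p a)
  -- since z^p a ∈ S.
  obtain ⟨q, hq, hq0⟩ := Sᗮ.ne_bot_iff.1 fun h => hne (S.orthogonal_eq_bot_iff.1 h)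
  obtain ⟨p, hp⟩ := hcon (V q) (hVS q) fun h => hq0 (by
    rw [← inner_self_eq_zero (𝕜 := ℂ), ← hV, h, inner_zero_left])
  apply hp
  have hWq : adjoint W q = 0 := ext_inner_left ℂ fun y => by
    rw [adjoint_inner_right, inner_zero_right]
    exact (Submodule.mem_orthogonal _ _).1 hq _ (hWS y)
  have e1 : ⟪monoMul p (W b), V q⟫_ℂ = 0 := by
    rw [← hWm, ← adjoint_inner_right, hWV, hWq, map_zero, inner_zero_right]
  rw [hf, map_add, inner_add_left, e1, ← hVm, hV, add_zero]
  exact (Submodule.mem_orthogonal _ _).1 hq _ (hS p a (hU0 a hUa))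

theorem mulTen_comm {φ₁ φ₂ : H1} (h₁ : IsIsometricMultiplier φ₁) (h₂ : IsIsometricMultiplier φ₂)
    (x : H2) : mulTen h₁ isIsometricMultiplier_unitVec_zero
      (mulTen isIsometricMultiplier_unitVec_zero h₂ x) =
    mulTen isIsometricMultiplier_unitVec_zero h₂
      (mulTen h₁ isIsometricMultiplier_unitVec_zero x) := by
  refine clm_ext_unitVec
    (A := (mulTen h₁ isIsometricMultiplier_unitVec_zero).toContinuousLinearMap ∘L
      (mulTen isIsometricMultiplier_unitVec_zero h₂).toContinuousLinearMap)
    (B := (mulTen isIsometricMultiplier_unitVec_zero h₂).toContinuousLinearMap ∘L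
      (mulTen h₁ isIsometricMultiplier_unitVec_zero).toContinuousLinearMap) (fun p => ?_) x
  rw [← Prod.mk.eta (p := p), ← ten_unitVec]
  simp [mulTen_ten, mulOp_one]

theorem adjoint_mulTen_comm {φ₁ φ₂ : H1} (h₁ : IsIsometricMultiplier φ₁)
    (h₂ : IsIsometricMultiplier φ₂) (x : H2) :
    adjoint (mulTen h₁ isIsometricMultiplier_unitVec_zero).toContinuousLinearMap
      (mulTen isIsometricMultiplier_unitVec_zero h₂ x) =
    mulTen isIsometricMultiplier_unitVec_zero h₂
      (adjoint (mulTen h₁ isIsometricMultiplier_unitVec_zero).toContinuousLinearMap x) := by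
  refine clm_ext_unitVec
    (A := adjoint (mulTen h₁ isIsometricMultiplier_unitVec_zero).toContinuousLinearMap ∘L
      (mulTen isIsometricMultiplier_unitVec_zero h₂).toContinuousLinearMap)
    (B := (mulTen isIsometricMultiplier_unitVec_zero h₂).toContinuousLinearMap ∘L
      adjoint (mulTen h₁ isIsometricMultiplier_unitVec_zero).toContinuousLinearMap) (fun p => ?_) x
  rw [← Prod.mk.eta (p := p), ← ten_unitVec]
  simp [mulTen_ten, mulOp_one, adjoint_mulTen_ten, adjoint_mulOp_one]

/-- Doubly commuting isometries: a vector of a subspace containing both ranges is a sum of elements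
of the ranges, if the subspace is small enough. -/
theorem exists_eq_add_of_doublyCommuting {S : Submodule ℂ H2} (V W : H2 →L[ℂ] H2)
    (hV : ∀ x, adjoint V (V x) = x) (hW : ∀ x, adjoint W (W x) = x)
    (hVW : ∀ x, adjoint V (W x) = W (adjoint V x)) (hcomm : ∀ x, V (W x) = W (V x))
    (hVS : ∀ x, V x ∈ S) (hWS : ∀ x, W x ∈ S)
    (hS : ∀ x, adjoint V x = 0 → adjoint W x = 0 → x ∈ Sᗮ) {f : H2} (hf : f ∈ S) :
    ∃ a b, f = V a + W b := by
  have hcomm' : ∀ x, adjoint V (adjoint W x) = adjoint W (adjoint V x) := fun x =>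
    ext_inner_left ℂ fun y => by
      rw [adjoint_inner_right, adjoint_inner_right, adjoint_inner_right, adjoint_inner_right,
        hcomm]
  -- The remainder is (1 - WW*)(1 - VV*)f, which is annihilated by V* and W*. It therefore lies in S
  -- ∩ Sᗮ.
  refine ⟨adjoint V f, adjoint W (f - V (adjoint V f)), ?_⟩
  have h1 : f - (V (adjoint V f) + W (adjoint W (f - V (adjoint V f)))) ∈ Sᗮ := by
    apply hS
    · rw [map_sub, map_add, hV, hVW, hcomm', map_sub (adjoint V), hV, sub_self, map_zero, map_zero,
        add_zero, sub_self]
    · rw [← sub_sub, map_sub, hW, sub_self]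
  have h2 : f - (V (adjoint V f) + W (adjoint W (f - V (adjoint V f)))) ∈ S :=
    S.sub_mem hf (S.add_mem (hVS _) (hWS _))
  have h3 := (Submodule.mem_orthogonal _ _).1 h1 _ h2
  rw [inner_self_eq_zero] at h3
  exact sub_eq_zero.1 h3

theorem IsTensorQuotient.exists_orthogonal_orbit {S : Submodule ℂ H2} (hS : IsHardySubmodule S)
    {p r : ℕ → H1} (h : IsTensorQuotient S p r) (hne : S ≠ ⊤) (hz : sliceZ S ≠ ⊥)
    (hw : sliceW S ≠ ⊥) {f : H2} (hf : f ∈ S) :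
    ∃ v ∈ S, v ≠ 0 ∧ ∀ p, ⟪monoMul p f, v⟫_ℂ = 0 := by
  obtain ⟨φ₁, h₁, hφ₁, hr₁⟩ := exists_eq_range_mulOp (isClosed_sliceZ hS) (shift_mem_sliceZ hS) hz
  obtain ⟨φ₂, h₂, hφ₂, hr₂⟩ := exists_eq_range_mulOp (isClosed_sliceW hS) (shift_mem_sliceW hS) hw
  -- The constant 1 as second factor makes these multiplications by φ₁(z) and φ₂(w) alone.
  obtain ⟨V, hV⟩ : ∃ V, V = mulTen h₁ isIsometricMultiplier_unitVec_zero := ⟨_, rfl⟩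
  obtain ⟨W, hW⟩ : ∃ W, W = mulTen isIsometricMultiplier_unitVec_zero h₂ := ⟨_, rfl⟩
  have hVS : ∀ x, V x ∈ S := fun x => by
    rw [hV]
    exact range_mulTen_le h₁ _ hS hφ₁ x
  have hWS : ∀ x, W x ∈ S := fun x => by
    rw [hW]
    exact range_mulTen_le _ h₂ hS hφ₂ x
  have hVt : ∀ a b, V (ten a b) = ten (mulOp φ₁ h₁ a) b := fun a b => by
    rw [hV, mulTen_ten, mulOp_one]
  have hWt : ∀ a b, W (ten a b) = ten a (mulOp φ₂ h₂ b) := fun a b => by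
    rw [hW, mulTen_ten, mulOp_one]
  have hVW : ∀ x, adjoint V.toContinuousLinearMap (W x) =
      W (adjoint V.toContinuousLinearMap x) := by
    rw [hV, hW]
    exact adjoint_mulTen_comm h₁ h₂
  have hiso : ∀ (A : H2 →ₗᵢ[ℂ] H2) (x : H2), adjoint A.toContinuousLinearMap (A x) = x :=
    fun A x => ext_inner_left ℂ fun y => by
      rw [adjoint_inner_right]
      exact A.inner_map_map y x
  obtain ⟨a, b, hab⟩ := exists_eq_add_of_doublyCommuting V.toContinuousLinearMap
    W.toContinuousLinearMap (hiso V) (hiso W) hVW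
    (fun x => by
      change V (W x) = W (V x)
      rw [hV, hW]
      exact mulTen_comm h₁ h₂ x) hVS hWS
    (fun x hx hx' => by
      refine h.mem_orthogonal hS (fun a ha b => ?_) (fun a b hb => ?_)
      · obtain ⟨y, rfl⟩ := hr₁ a ha
        rw [← hVt]
        exact (adjoint_inner_right V.toContinuousLinearMap _ _).symm.trans
          (by rw [hx, inner_zero_right])
      · obtain ⟨y, rfl⟩ := hr₂ b hb
        rw [← hWt]
        exact (adjoint_inner_right W.toContinuousLinearMap _ _).symm.trans
          (by rw [hx', inner_zero_right])) hf
  refine HardyBidisc.exists_orthogonal_orbit hne hS.isClosed V.toContinuousLinearMap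
    W.toContinuousLinearMap (hankel h₁ h₂) V.inner_map_map W.inner_map_map ?_ ?_ hVW hVS hWS
    (fun p x hx => monoMul_mem hS hx p) (inner_hankel_comm h₁ h₂) (inner_monoMul_hankel h₁ h₂)
    ?_ ?_ (fun x hx => mem_of_hankel_eq_zero h₁ h₂ hS h hφ₁ hφ₂ hx) hab
  · rw [hV]
    exact mulTen_monoMul h₁ isIsometricMultiplier_unitVec_zero
  · rw [hW]
    exact mulTen_monoMul isIsometricMultiplier_unitVec_zero h₂
  · rw [hV]
    exact hankel_mulTen_left h₁ h₂
  · rw [hW]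
    exact hankel_mulTen_right h₁ h₂

/-! ### Evaluation -/

theorem memℓp_conj_pow {z : ℂ} (hz : ‖z‖ < 1) :
    Memℓp (E := fun _ : ℕ => ℂ) (fun n => starRingEnd ℂ (z ^ n)) 2 := by
  refine memℓp_gen ?_
  have h : ‖z‖ ^ 2 < 1 := pow_lt_one₀ (norm_nonneg z) hz two_ne_zero
  refine (summable_geometric_of_lt_one (by positivity) h).congr fun n => ?_
  rw [RCLike.norm_conj, norm_pow, ENNReal.toReal_ofNat, Real.rpow_ofNat, ← pow_mul, ← pow_mul,
    mul_comm]

/-- The Szegő kernel -/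
def szego (z : ℂ) (hz : ‖z‖ < 1) : H1 := ⟨fun n => starRingEnd ℂ (z ^ n), memℓp_conj_pow hz⟩

theorem hasSum_inner_szego {z : ℂ} (hz : ‖z‖ < 1) (x : H1) :
    HasSum (fun n => x n * z ^ n) ⟪szego z hz, x⟫_ℂ := by
  have h := hasSum_inner_coeff (szego z hz) x
  have h2 : (fun n => x n * starRingEnd ℂ (szego z hz n)) = fun n => x n * z ^ n :=
    funext fun n => congrArg (x n * ·) (RCLike.conj_conj _)
  rwa [h2] at h

theorem inner_ten_szego {z w : ℂ} (hz : ‖z‖ < 1) (hw : ‖w‖ < 1) (F : H2) :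
    ⟪ten (szego z hz) (szego w hw), F⟫_ℂ = eval F z w := by
  have h := hasSum_inner_coeff (ten (szego z hz) (szego w hw)) F
  have h2 : (fun p => F p * starRingEnd ℂ (ten (szego z hz) (szego w hw) p)) =
      fun p => F p * (z ^ p.1 * w ^ p.2) :=
    funext fun p => congrArg (F p * ·) (by
      rw [ten_apply, map_mul]
      exact congrArg₂ (· * ·) (RCLike.conj_conj _) (RCLike.conj_conj _))
  rw [h2] at h
  exact h.unique (hasSum_eval F hz hw)

theorem inner_szego_shiftPow {z : ℂ} (hz : ‖z‖ < 1) (n : ℕ) (x : H1) :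
    ⟪szego z hz, shiftPow n x⟫_ℂ = z ^ n * ⟪szego z hz, x⟫_ℂ := by
  have hu : ∀ m, ⟪szego z hz, unitVec m⟫_ℂ = z ^ m := fun m => by
    rw [← inner_conj_symm, inner_unitVec_left]
    exact RCLike.conj_conj _
  refine clm_ext_unitVec (A := innerSL ℂ (szego z hz) ∘L (shiftPow n).toContinuousLinearMap)
    (B := z ^ n • innerSL ℂ (szego z hz)) (fun m => ?_) x
  simp [shiftPow_unitVec, hu, pow_add]

theorem inner_szego_mulOp {z : ℂ} (hz : ‖z‖ < 1) {φ : H1} (hφ : IsIsometricMultiplier φ) (x : H1) :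
    ⟪szego z hz, mulOp φ hφ x⟫_ℂ = ⟪szego z hz, φ⟫_ℂ * ⟪szego z hz, x⟫_ℂ := by
  refine clm_ext_unitVec (A := innerSL ℂ (szego z hz) ∘L (mulOp φ hφ).toContinuousLinearMap)
    (B := ⟪szego z hz, φ⟫_ℂ • innerSL ℂ (szego z hz)) (fun m => ?_) x
  have h : ⟪szego z hz, unitVec m⟫_ℂ = z ^ m := by
    rw [← inner_conj_symm, inner_unitVec_left]
    exact RCLike.conj_conj _
  simp [mulOp_unitVec, inner_szego_shiftPow, h, mul_comm]

/-- For the Szegő kernel k at z, ⟨k, φk⟩ = φ(z)‖k‖², while ‖φk‖ = ‖k‖; Cauchy–Schwarz then bounds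
|φ(z)| by 1. -/
theorem norm_inner_szego_le {z : ℂ} (hz : ‖z‖ < 1) {φ : H1} (hφ : IsIsometricMultiplier φ) :
    ‖⟪szego z hz, φ⟫_ℂ‖ ≤ 1 := by
  have hne : szego z hz ≠ 0 := fun h => by
    have h0 : szego z hz 0 = 1 := by
      change starRingEnd ℂ (z ^ 0) = 1
      simp
    rw [h] at h0
    exact zero_ne_one h0
  have h1 := norm_inner_le_norm (𝕜 := ℂ) (szego z hz) (mulOp φ hφ (szego z hz))
  rw [inner_szego_mulOp, norm_mul, LinearIsometry.norm_map, inner_self_eq_norm_sq_to_K, norm_pow,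
    RCLike.norm_ofReal, abs_norm, ← sq] at h1
  have h2 : 0 < ‖szego z hz‖ ^ 2 := pow_pos (norm_pos_iff.2 hne) 2
  exact le_of_mul_le_mul_right (by rwa [one_mul]) h2

theorem eval_mulTen {φ₁ φ₂ : H1} (h₁ : IsIsometricMultiplier φ₁) (h₂ : IsIsometricMultiplier φ₂)
    (G : H2) {z w : ℂ} (hz : ‖z‖ < 1) (hw : ‖w‖ < 1) :
    eval (mulTen h₁ h₂ G) z w =
      ⟪szego z hz, φ₁⟫_ℂ * ⟪szego w hw, φ₂⟫_ℂ * eval G z w := by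
  rw [← inner_ten_szego hz hw, ← inner_ten_szego hz hw]
  refine clm_ext_unitVec
    (A := innerSL ℂ (ten (szego z hz) (szego w hw)) ∘L (mulTen h₁ h₂).toContinuousLinearMap)
    (B := (⟪szego z hz, φ₁⟫_ℂ * ⟪szego w hw, φ₂⟫_ℂ) • innerSL ℂ (ten (szego z hz) (szego w hw)))
    (fun p => ?_) G
  rw [← Prod.mk.eta (p := p), ← ten_unitVec]
  simp [mulTen_ten, inner_ten, inner_szego_mulOp]
  ring

theorem mulRange_eq_range_mulTen {φ₁ φ₂ : H1} (h₁ : IsIsometricMultiplier φ₁)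
    (h₂ : IsIsometricMultiplier φ₂) {Θ : ℂ → ℂ → ℂ}
    (hΘ : ∀ z w : ℂ, ∀ (hz : ‖z‖ < 1) (hw : ‖w‖ < 1),
      Θ z w = ⟪szego z hz, φ₁⟫_ℂ * ⟪szego w hw, φ₂⟫_ℂ) :
    mulRange Θ = Set.range (mulTen h₁ h₂) := by
  ext F
  constructor
  · rintro ⟨G, hG⟩
    refine ⟨G, eval_injective fun z w hz hw => ?_⟩
    rw [hG z w hz hw, eval_mulTen h₁ h₂ G hz hw, hΘ z w hz hw]
  · rintro ⟨G, rfl⟩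
    refine ⟨G, fun z w hz hw => ?_⟩
    rw [eval_mulTen h₁ h₂ G hz hw, hΘ z w hz hw]

theorem inner_szego_one {z : ℂ} (hz : ‖z‖ < 1) : ⟪szego z hz, unitVec 0⟫_ℂ = 1 := by
  rw [← inner_conj_symm, inner_unitVec_left]
  exact (RCLike.conj_conj _).trans (pow_zero z)

theorem differentiableOn_tsum_coeff (x : H1) :
    DifferentiableOn ℂ (fun z => ∑' n, x n * z ^ n) (Metric.ball 0 1) := by
  intro z hz
  have hz1 : ‖z‖ < 1 := by simpa using hz
  obtain ⟨ρ, hzρ, hρ1⟩ := exists_between hz1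
  have hρ0 : 0 ≤ ρ := (norm_nonneg z).trans hzρ.le
  have h : DifferentiableOn ℂ (fun z => ∑' n, x n * z ^ n) (Metric.ball 0 ρ) := by
    refine Complex.differentiableOn_tsum_of_summable_norm
      ((summable_geometric_of_lt_one hρ0 hρ1).mul_left ‖x‖) (fun n => by fun_prop)
      Metric.isOpen_ball fun n w hw => ?_
    have hw' : ‖w‖ < ρ := by simpa using hw
    rw [norm_mul, norm_pow]
    exact mul_le_mul (lp.norm_apply_le_norm (by norm_num) x n)
      (pow_le_pow_left₀ (norm_nonneg w) hw'.le n) (by positivity) (norm_nonneg x)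
  exact (h.differentiableAt (Metric.isOpen_ball.mem_nhds (by simpa using hzρ))).differentiableWithinAt

/-! ### Boundary functions -/

/-- The boundary function of an element of `H²(𝔻)`. -/
def boundary : H1 →ₗᵢ[ℂ] Lp ℂ 2 (haarAddCircle (T := 1)) :=
  ofOrthonormal (fun n : ℕ => fourierLp 2 (n : ℤ)) (orthonormal_fourier.comp _ Nat.cast_injective)

theorem fourierCoeff_boundary_eq_inner (x : H1) (n : ℤ) :
    fourierCoeff (boundary x) n = ⟪fourierLp (T := 1) 2 n, boundary x⟫_ℂ := by
  rw [← fourierBasis_repr, HilbertBasis.repr_apply_apply, coe_fourierBasis]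

theorem fourierCoeff_boundary_natCast (x : H1) (n : ℕ) :
    fourierCoeff (boundary x) (n : ℤ) = x n := by
  have h : boundary (unitVec n) = fourierLp (T := 1) 2 (n : ℤ) := ofOrthonormal_unitVec _ _ n
  rw [fourierCoeff_boundary_eq_inner, ← h, LinearIsometry.inner_map_map, inner_unitVec_left]

theorem fourierCoeff_boundary_of_neg (x : H1) {n : ℤ} (hn : n < 0) :
    fourierCoeff (boundary x) n = 0 := by
  rw [fourierCoeff_boundary_eq_inner]
  refine clm_ext_unitVec (A := innerSL ℂ (fourierLp (T := 1) 2 n) ∘L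
    boundary.toContinuousLinearMap) (B := 0) (fun m => ?_) x
  have h : boundary (unitVec m) = fourierLp (T := 1) 2 (m : ℤ) := ofOrthonormal_unitVec _ _ m
  change ⟪fourierLp (T := 1) 2 n, boundary (unitVec m)⟫_ℂ = 0
  rw [h]
  exact orthonormal_fourier.2 (by omega)

theorem Lp_ext_fourierCoeff {f g : Lp ℂ 2 (haarAddCircle (T := 1))}
    (h : ∀ n, fourierCoeff f n = fourierCoeff g n) : f = g := by
  apply fourierBasis.repr.injective
  ext n
  rw [fourierBasis_repr, fourierBasis_repr, h]

theorem boundary_shiftPow (m : ℕ) (x : H1) :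
    boundary (shiftPow m x) =ᵐ[haarAddCircle] fun t => fourier (m : ℤ) t * boundary x t := by
  have hmem : MemLp (fun t => fourier (m : ℤ) t * boundary x t) 2 (haarAddCircle (T := 1)) := by
    refine (Lp.memLp (boundary x)).of_le ?_ (Filter.Eventually.of_forall fun t => ?_)
    · exact (fourier (m : ℤ)).continuous.aestronglyMeasurable.mul (Lp.aestronglyMeasurable _)
    · rw [norm_mul, fourier_apply, Circle.norm_coe, one_mul]
  have h : boundary (shiftPow m x) = hmem.toLp := by
    refine Lp_ext_fourierCoeff fun n => ?_
    have h1 : fourierCoeff hmem.toLp n = fourierCoeff (boundary x) (n - m) := by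
      rw [fourierCoeff_congr_ae hmem.coeFn_toLp, fourierCoeff, fourierCoeff]
      refine integral_congr_ae (Filter.Eventually.of_forall fun t => ?_)
      change fourier (-n) t • (fourier (m : ℤ) t * boundary x t) =
        fourier (-(n - m)) t • boundary x t
      rw [smul_eq_mul, smul_eq_mul, ← mul_assoc, ← fourier_add, neg_sub, neg_add_eq_sub]
    rw [h1]
    rcases lt_or_ge n 0 with hn | hn
    · rw [fourierCoeff_boundary_of_neg _ hn, fourierCoeff_boundary_of_neg _ (by omega)]
    · lift n to ℕ using hn
      rw [fourierCoeff_boundary_natCast]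
      rcases lt_or_ge n m with hnm | hnm
      · rw [shiftPow_apply_of_lt hnm, fourierCoeff_boundary_of_neg _ (by omega)]
      · obtain ⟨k, rfl⟩ := Nat.exists_eq_add_of_le hnm
        rw [shiftPow_apply_add, Nat.cast_add, add_sub_cancel_left, fourierCoeff_boundary_natCast]
  rw [h]
  exact hmem.coeFn_toLp

/-- On the circle the shift is multiplication by a character. The Gram matrix of the zⁿx is thus the
Toeplitz matrix of the squared modulus of the boundary function. -/
theorem inner_shiftPow_shiftPow (x : H1) (m n : ℕ) :
    ⟪shiftPow m x, shiftPow n x⟫_ℂ =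
      fourierCoeff (fun t => ((‖boundary x t‖ ^ 2 : ℝ) : ℂ)) ((m : ℤ) - n) := by
  rw [← boundary.inner_map_map, L2.inner_def, fourierCoeff]
  refine integral_congr_ae ?_
  filter_upwards [boundary_shiftPow m x, boundary_shiftPow n x] with t hm hn
  rw [hm, hn, RCLike.inner_apply, map_mul, ← fourier_neg, neg_sub, sub_eq_add_neg, fourier_add,
    smul_eq_mul, Complex.ofReal_pow, ← Complex.conj_mul']
  ring

theorem fourierCoeff_one (n : ℤ) :
    fourierCoeff (fun _ : AddCircle (1 : ℝ) => (1 : ℂ)) n = if n = 0 then 1 else 0 := by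
  have h : (fun _ : AddCircle (1 : ℝ) => (1 : ℂ)) = fourier 0 := funext fun t => fourier_zero.symm
  rw [h, fourierCoeff_fourier, Pi.single_apply]

/-- Integration against u is a continuous functional on C(𝕋) that vanishes on the dense span of the
characters. -/
theorem integral_continuous_mul_eq_zero {u : AddCircle (1 : ℝ) → ℂ}
    (hu : Integrable u haarAddCircle) (h : ∀ n, fourierCoeff u n = 0)
    (f : C(AddCircle (1 : ℝ), ℂ)) : ∫ t, f t * u t ∂haarAddCircle = 0 := by
  have hint : ∀ f : C(AddCircle (1 : ℝ), ℂ), Integrable (fun t => f t * u t) haarAddCircle :=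
    fun f => hu.bdd_mul f.continuous.aestronglyMeasurable
      (Filter.Eventually.of_forall f.norm_coe_le_norm)
  let L : C(AddCircle (1 : ℝ), ℂ) →L[ℂ] ℂ := LinearMap.mkContinuous
    { toFun := fun f => ∫ t, f t * u t ∂haarAddCircle
      map_add' := fun f g => by
        rw [← integral_add (hint f) (hint g)]
        exact integral_congr_ae (Filter.Eventually.of_forall fun t => add_mul _ _ _)
      map_smul' := fun c f => by
        rw [RingHom.id_apply, smul_eq_mul, ← integral_const_mul]
        exact integral_congr_ae (Filter.Eventually.of_forall fun t => mul_assoc _ _ _) }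
    (∫ t, ‖u t‖ ∂haarAddCircle) fun f => by
      refine (norm_integral_le_integral_norm _).trans ?_
      rw [mul_comm, ← integral_const_mul]
      refine integral_mono (hint f).norm (hu.norm.const_mul _) fun t => ?_
      change ‖f t * u t‖ ≤ ‖f‖ * ‖u t‖
      rw [norm_mul]
      exact mul_le_mul_of_nonneg_right (f.norm_coe_le_norm t) (norm_nonneg _)
  have hle : (Submodule.span ℂ (Set.range (fourier (T := 1)))).topologicalClosure ≤ L.ker := by
    refine Submodule.topologicalClosure_minimal _ (Submodule.span_le.2 ?_) L.isClosed_ker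
    rintro _ ⟨n, rfl⟩
    have := h (-n)
    rw [fourierCoeff, neg_neg] at this
    exact this
  rw [span_fourier_closure_eq_top] at hle
  exact hle (Submodule.mem_top (x := f))

theorem ae_norm_eq_one {g : Lp ℂ 2 (haarAddCircle (T := 1))}
    (h : ∀ n, fourierCoeff (fun t => ((‖g t‖ ^ 2 : ℝ) : ℂ)) n = if n = 0 then 1 else 0) :
    ∀ᵐ t ∂(haarAddCircle (T := 1)), ‖g t‖ = 1 := by
  have hu : Integrable (fun t => ‖g t‖ ^ 2) (haarAddCircle (T := 1)) := by
    simpa using (Lp.memLp g).integrable_norm_pow two_ne_zero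
  have hu' : Integrable (fun t => ((‖g t‖ ^ 2 : ℝ) : ℂ)) (haarAddCircle (T := 1)) := hu.ofReal
  have hzero : ∀ n, fourierCoeff (fun t => ((‖g t‖ ^ 2 : ℝ) : ℂ) - 1) n = 0 := fun n => by
    have h1 : ∀ u : AddCircle (1 : ℝ) → ℂ, Integrable u haarAddCircle →
        Integrable (fun t => fourier (-n) t • u t) haarAddCircle := fun u hu => hu.fourier_smul _
    have h2 := h n
    rw [← fourierCoeff_one n, ← sub_eq_zero, fourierCoeff, fourierCoeff,
      ← integral_sub (h1 _ hu') (h1 _ (integrable_const 1))] at h2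
    rw [fourierCoeff, ← h2]
    exact integral_congr_ae (Filter.Eventually.of_forall fun t => smul_sub _ _ _)
  have hint := integral_continuous_mul_eq_zero (hu'.sub (integrable_const 1)) hzero
  have hmeas : AEMeasurable (fun t => ENNReal.ofReal (‖g t‖ ^ 2)) (haarAddCircle (T := 1)) :=
    hu.aestronglyMeasurable.aemeasurable.ennreal_ofReal
  have hfin : ∫⁻ t, ENNReal.ofReal (‖g t‖ ^ 2) ∂(haarAddCircle (T := 1)) ≠ ∞ :=
    ((hasFiniteIntegral_iff_ofReal
      (Filter.Eventually.of_forall fun t => sq_nonneg ‖g t‖)).1 hu.hasFiniteIntegral).ne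
  have : IsFiniteMeasure ((haarAddCircle (T := 1)).withDensity
      fun t => ENNReal.ofReal (‖g t‖ ^ 2)) := isFiniteMeasure_withDensity hfin
  -- Continuous functions separate finite measures, so |g|² dt = dt; uniqueness of densities then
  -- gives |g|² = 1 almost everywhere.
  have hν : (haarAddCircle (T := 1)).withDensity (fun t => ENNReal.ofReal (‖g t‖ ^ 2)) =
      (haarAddCircle (T := 1)).withDensity 1 := by
    rw [withDensity_one]
    refine ext_of_forall_integral_eq_of_IsFiniteMeasure fun f => ?_
    rw [integral_withDensity_eq_integral_toReal_smul₀ hmeas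
      (Filter.Eventually.of_forall fun _ => ENNReal.ofReal_lt_top)]
    have h3 := hint ⟨fun t => (f t : ℂ), by fun_prop⟩
    have hf : Integrable f (haarAddCircle (T := 1)) := f.integrable _
    have hfu : Integrable (fun t => f t * ‖g t‖ ^ 2) (haarAddCircle (T := 1)) :=
      hu.bdd_mul f.continuous.aestronglyMeasurable
        (Filter.Eventually.of_forall f.norm_coe_le_norm)
    have h4 : ((∫ t, (f t * ‖g t‖ ^ 2 - f t) ∂(haarAddCircle (T := 1)) : ℝ) : ℂ) = 0 := by
      rw [← integral_complex_ofReal, ← h3]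
      refine integral_congr_ae (Filter.Eventually.of_forall fun t => ?_)
      simp [mul_sub]
    rw [Complex.ofReal_eq_zero, integral_sub hfu hf, sub_eq_zero] at h4
    rw [← h4]
    refine integral_congr_ae (Filter.Eventually.of_forall fun t => ?_)
    simp [mul_comm]
  have hae := (withDensity_eq_iff hmeas aemeasurable_const hfin).1 hν
  filter_upwards [hae] with t ht
  have h4 : ‖g t‖ ^ 2 = 1 := by
    rw [← ENNReal.toReal_ofReal (sq_nonneg ‖g t‖), ht]
    simp
  exact (pow_eq_one_iff_of_nonneg (norm_nonneg _) two_ne_zero).1 h4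

/-! ### Inner functions are isometric multipliers -/

theorem IsIsometricMultiplier.isInner {φ : H1} (hφ : IsIsometricMultiplier φ) :
    IsInner fun z => ∑' n, φ n * z ^ n where
  holomorphic := differentiableOn_tsum_coeff φ
  bounded := ⟨1, fun z hz => by
    rw [(hasSum_inner_szego hz φ).tsum_eq]
    exact norm_inner_szego_le hz hφ⟩
  unimodular := by
    refine ⟨boundary φ, ⟨fun n hn => fourierCoeff_boundary_of_neg φ hn, fun z hz => ?_⟩, ?_⟩
    · simp only [fourierCoeff_boundary_natCast]
      exact (hasSum_inner_szego hz φ).summable.hasSum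
    · refine ae_norm_eq_one fun n => ?_
      -- Every integer is a difference of two natural numbers, so the Gram matrix of the zⁿφ sees
      -- all Fourier coefficients.
      obtain ⟨a, b, rfl⟩ : ∃ a b : ℕ, n = (a : ℤ) - b :=
        ⟨n.toNat, (-n).toNat, by omega⟩
      rw [← inner_shiftPow_shiftPow, orthonormal_iff_ite.1 hφ]
      exact if_congr (by omega) rfl rfl

theorem IsInner.exists_isIsometricMultiplier {φ : ℂ → ℂ} (hφ : IsInner φ) :
    ∃ a : H1, IsIsometricMultiplier a ∧ ∀ z, ∀ hz : ‖z‖ < 1, φ z = ⟪szego z hz, a⟫_ℂ := by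
  obtain ⟨g, hg, hg1⟩ := hφ.unimodular
  have hmem : Memℓp (E := fun _ : ℕ => ℂ) (fun n : ℕ => fourierCoeff g (n : ℤ)) 2 := by
    refine memℓp_gen ?_
    have h1 := (lp.memℓp (fourierBasis (T := 1).repr g)).summable (by norm_num)
    refine (h1.comp_injective (Nat.cast_injective (R := ℤ))).congr fun n => ?_
    rw [Function.comp_apply, fourierBasis_repr]
  have hb : boundary ⟨_, hmem⟩ = g := by
    refine Lp_ext_fourierCoeff fun n => ?_
    rcases lt_or_ge n 0 with hn | hn
    · rw [fourierCoeff_boundary_of_neg _ hn, hg.fourierCoeff_neg n hn]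
    · lift n to ℕ using hn
      rw [fourierCoeff_boundary_natCast]
  refine ⟨⟨_, hmem⟩, orthonormal_iff_ite.2 fun m n => ?_, fun z hz => ?_⟩
  · have h1 : fourierCoeff (fun t => ((‖g t‖ ^ 2 : ℝ) : ℂ)) ((m : ℤ) - n) =
        fourierCoeff (fun _ : AddCircle (1 : ℝ) => (1 : ℂ)) ((m : ℤ) - n) := by
      refine congrFun (fourierCoeff_congr_ae ?_) _
      filter_upwards [hg1] with t ht
      simp [ht]
    rw [inner_shiftPow_shiftPow, hb, h1, fourierCoeff_one]
    exact if_congr (by omega) rfl rfl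
  · exact (hg.hasSum z hz).unique (hasSum_inner_szego hz ⟨_, hmem⟩)

/-! ### Rank one submodules -/

section Rank

variable {S : Submodule ℂ H2}

/-- The pair `(M_z|_S, M_w|_S)`. -/
def restrictedShifts (hS : IsHardySubmodule S) : Fin 2 → S →L[ℂ] S :=
  ![(Mz ∘L S.subtypeL).codRestrict S fun F => hS.mz_mem F F.2,
    (Mw ∘L S.subtypeL).codRestrict S fun F => hS.mw_mem F F.2]

theorem coe_restrictedShifts_prod (hS : IsHardySubmodule S) (k : Fin 2 → ℕ) (f : S) :
    ((List.ofFn fun i => restrictedShifts hS i ^ k i).prod f : H2) =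
      monoMul (k 0, k 1) f := by
  have hz : ∀ (n : ℕ) (f : S), ((restrictedShifts hS 0 ^ n) f : H2) = (Mz ^ n) f := by
    intro n
    induction n with
    | zero => exact fun f => rfl
    | succ n ih =>
      intro f
      rw [pow_succ', pow_succ', mul_apply_eq_comp, mul_apply_eq_comp, ← ih]
      rfl
  have hw : ∀ (n : ℕ) (f : S), ((restrictedShifts hS 1 ^ n) f : H2) = (Mw ^ n) f := by
    intro n
    induction n with
    | zero => exact fun f => rfl
    | succ n ih =>
      intro f
      rw [pow_succ', pow_succ', mul_apply_eq_comp, mul_apply_eq_comp, ← ih]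
      rfl
  simp only [List.ofFn_succ, List.ofFn_zero, List.prod_cons, List.prod_nil, mul_one,
    mul_apply_eq_comp, Fin.succ_zero_eq_one]
  rw [hz, hw, monoMul, mul_apply_eq_comp]

theorem rank_eq_sInf (hS : IsHardySubmodule S) : hS.rank =
    sInf {c : Cardinal | ∃ E : Set S, generatedSubspace (restrictedShifts hS) E = ⊤ ∧
      c = Cardinal.mk E} :=
  rfl

theorem exists_generator (hS : IsHardySubmodule S) (h : hS.rank = 1) :
    ∃ f : S, generatedSubspace (restrictedShifts hS) {f} = ⊤ := by
  rw [rank_eq_sInf] at h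
  have hne : {c : Cardinal | ∃ E : Set S, generatedSubspace (restrictedShifts hS) E = ⊤ ∧
      c = Cardinal.mk E}.Nonempty := by
    -- The infimum of the empty set of cardinals is 0, so rank 1 guarantees that a generating set
    -- exists and that the infimum is attained.
    by_contra h0
    rw [Set.not_nonempty_iff_eq_empty.1 h0, Cardinal.sInf_empty] at h
    exact zero_ne_one h
  obtain ⟨E, hE, hc⟩ := csInf_mem hne
  rw [h, eq_comm, Cardinal.mk_set_eq_one_iff] at hc
  obtain ⟨f, rfl⟩ := hc
  exact ⟨f, hE⟩

theorem eq_zero_of_orthogonal_orbit (hS : IsHardySubmodule S) {f v : S}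
    (hf : generatedSubspace (restrictedShifts hS) {f} = ⊤)
    (hv : ∀ p, ⟪monoMul p f, (v : H2)⟫_ℂ = 0) : v = 0 := by
  have hle : generatedSubspace (restrictedShifts hS) {f} ≤ (innerSL ℂ v).ker := by
    refine Submodule.topologicalClosure_minimal _ (Submodule.span_le.2 ?_)
      (innerSL ℂ v).isClosed_ker
    rintro _ ⟨k, _, rfl, rfl⟩
    change ⟪(v : H2), ((List.ofFn fun i => restrictedShifts hS i ^ k i).prod _ : S)⟫_ℂ = 0
    rw [coe_restrictedShifts_prod, inner_eq_zero_symm, hv]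
  rw [hf] at hle
  exact inner_self_eq_zero.1 (hle (Submodule.mem_top (x := v)) : ⟪v, v⟫_ℂ = 0)

theorem rank_ne_one_of_eq_bot (hS : IsHardySubmodule S) (h : S = ⊥) : hS.rank ≠ 1 := by
  intro h1
  have hsub : Subsingleton S := by
    rw [h]
    infer_instance
  have h2 : hS.rank ≤ 0 := csInf_le' ⟨∅, Subsingleton.elim _ _, (Cardinal.mk_eq_zero _).symm⟩
  rw [h1] at h2
  exact not_le.2 zero_lt_one h2

/-- The image of 1 generates, since V intertwines the monomial multipliers. The empty set does not,
since it generates only 0. -/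
theorem rank_eq_one_of_eq_range (hS : IsHardySubmodule S) (V : H2 →ₗᵢ[ℂ] H2)
    (hV : ∀ p x, V (monoMul p x) = monoMul p (V x)) (hSV : (S : Set H2) = Set.range V) :
    hS.rank = 1 := by
  have hmem : ∀ x, V x ∈ S := fun x => by
    rw [← SetLike.mem_coe, hSV]
    exact ⟨x, rfl⟩
  let f : S := ⟨V (unitVec 0), hmem _⟩
  have hf0 : f ≠ 0 := fun h => by
    have h1 : V (unitVec 0) = 0 := congrArg Subtype.val h
    have h2 : ‖(unitVec 0 : H2)‖ = 1 := orthonormal_unitVec.1 0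
    rw [← V.norm_map, h1, norm_zero] at h2
    exact zero_ne_one h2
  rw [rank_eq_sInf]
  apply le_antisymm
  · refine csInf_le' ⟨{f}, ?_, (Cardinal.mk_singleton f).symm⟩
    refine Submodule.eq_top_iff'.2 fun x => ?_
    obtain ⟨y, hy⟩ : (x : H2) ∈ Set.range V := by
      rw [← hSV]
      exact x.2
    let V' : H2 →L[ℂ] S := V.toContinuousLinearMap.codRestrict S hmem
    have hx : x = V' y := Subtype.ext hy.symm
    rw [hx]
    refine mem_of_unitVec_mem
      (K := (generatedSubspace (restrictedShifts hS) {f}).comap V'.toLinearMap)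
      ((Submodule.isClosed_topologicalClosure _).preimage V'.continuous) (fun p => ?_) y
    refine Submodule.le_topologicalClosure _ (Submodule.subset_span ⟨![p.1, p.2], f, rfl, ?_⟩)
    apply Subtype.ext
    rw [coe_restrictedShifts_prod]
    change V (unitVec p) = monoMul p (V (unitVec 0))
    rw [← hV, monoMul_unitVec, add_zero]
  · refine le_csInf ⟨_, Set.univ, ?_, rfl⟩ ?_
    · refine Submodule.eq_top_iff'.2 fun x => Submodule.le_topologicalClosure _
        (Submodule.subset_span ⟨0, x, trivial, ?_⟩)
      apply Subtype.ext
      rw [coe_restrictedShifts_prod]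
      rfl
    · rintro _ ⟨E, hE, rfl⟩
      rw [Cardinal.one_le_iff_ne_zero, Cardinal.mk_ne_zero_iff]
      by_contra hempty
      rw [Set.nonempty_coe_sort, Set.not_nonempty_iff_eq_empty] at hempty
      subst hempty
      refine hf0 ?_
      have h1 : f ∈ generatedSubspace (restrictedShifts hS) ∅ := by
        rw [hE]
        trivial
      have h2 : {x : S | ∃ k : Fin 2 → ℕ, ∃ e ∈ (∅ : Set S),
          x = (List.ofFn fun i => restrictedShifts hS i ^ k i).prod e} = ∅ := by
        simp
      rw [generatedSubspace, h2, Submodule.span_empty,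
        (isClosed_singleton (x := (0 : S))).submodule_topologicalClosure_eq] at h1
      exact h1

/-- For f ∈ S the vector f - VV*f lies in S and is orthogonal to the range of V, so it lies in S ∩
Sᗮ. -/
theorem eq_range_of_orthogonal (V : H2 →ₗᵢ[ℂ] H2) (hVS : ∀ x, V x ∈ S)
    (h : ∀ x, (∀ y, ⟪V y, x⟫_ℂ = 0) → x ∈ Sᗮ) : (S : Set H2) = Set.range V := by
  ext f
  refine ⟨fun hf => ?_, ?_⟩
  · set g := adjoint V.toContinuousLinearMap f with hg
    have h1 : f - V g ∈ Sᗮ := h _ fun y => by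
      rw [inner_sub_right, V.inner_map_map, hg, adjoint_inner_right]
      exact sub_self _
    have h2 := (Submodule.mem_orthogonal _ _).1 h1 _ (S.sub_mem hf (hVS g))
    rw [inner_self_eq_zero, sub_eq_zero] at h2
    exact ⟨g, h2.symm⟩
  · rintro ⟨x, rfl⟩
    exact hVS x

theorem exists_inner_of_eq_range_left {φ : H1} (hφ : IsIsometricMultiplier φ)
    (hS : (S : Set H2) = Set.range (mulTen hφ isIsometricMultiplier_unitVec_zero)) :
    ∃ Θ : ℂ → ℂ → ℂ, IsOneVariableInner Θ ∧ (S : Set H2) = mulRange Θ := by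
  refine ⟨fun z _ => ∑' n, φ n * z ^ n, ⟨_, hφ.isInner, Or.inl fun _ _ _ _ => rfl⟩, ?_⟩
  rw [hS, mulRange_eq_range_mulTen hφ isIsometricMultiplier_unitVec_zero]
  intro z w hz hw
  rw [inner_szego_one, mul_one, (hasSum_inner_szego hz φ).tsum_eq]

theorem exists_inner_of_eq_range_right {φ : H1} (hφ : IsIsometricMultiplier φ)
    (hS : (S : Set H2) = Set.range (mulTen isIsometricMultiplier_unitVec_zero hφ)) :
    ∃ Θ : ℂ → ℂ → ℂ, IsOneVariableInner Θ ∧ (S : Set H2) = mulRange Θ := by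
  refine ⟨fun _ w => ∑' n, φ n * w ^ n, ⟨_, hφ.isInner, Or.inr fun _ _ _ _ => rfl⟩, ?_⟩
  rw [hS, mulRange_eq_range_mulTen isIsometricMultiplier_unitVec_zero hφ]
  intro z w hz hw
  rw [inner_szego_one, one_mul, (hasSum_inner_szego hw φ).tsum_eq]

theorem exists_inner_of_rank_eq_one (hS : IsCoDoublyCommuting S)
    (h1 : hS.toIsHardySubmodule.rank = 1) :
    ∃ Θ : ℂ → ℂ → ℂ, IsOneVariableInner Θ ∧ (S : Set H2) = mulRange Θ := by
  have hH := hS.toIsHardySubmodule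
  -- Here P_Q 1 = 0 and the tensor factorization is unavailable; the constant 1 serves as the inner
  -- function.
  by_cases htop : S = ⊤
  · refine exists_inner_of_eq_range_left isIsometricMultiplier_unitVec_zero
      (eq_range_of_orthogonal _ (fun x => htop ▸ trivial) fun x hx => ?_)
    have hx0 : x = 0 := by
      refine ext_inner_unitVec fun p => ?_
      have := hx (unitVec p)
      rwa [← Prod.mk.eta (p := p), ← ten_unitVec, mulTen_ten, mulOp_one, mulOp_one,
        ← inner_zero_right (unitVec p), ten_unitVec] at this
    rw [hx0]
    exact zero_mem _
  obtain ⟨p, r, h⟩ := exists_isTensorQuotient hS htop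
  by_cases hz : sliceZ S = ⊥
  · by_cases hw : sliceW S = ⊥
    · refine absurd h1 (rank_ne_one_of_eq_bot hH ?_)
      rw [eq_bot_iff]
      intro x hx
      have hxo : x ∈ Sᗮ := h.mem_orthogonal hH
        (fun a ha b => by
          rw [hz, Submodule.mem_bot] at ha
          rw [ha, ← tenRight_apply, map_zero, inner_zero_left])
        (fun a b hb => by
          rw [hw, Submodule.mem_bot] at hb
          rw [hb, ← tenLeft_apply, map_zero, inner_zero_left])
      exact inner_self_eq_zero.1 ((Submodule.mem_orthogonal _ _).1 hxo x hx)
    · obtain ⟨φ, hφ, hmem, hr⟩ :=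
        exists_eq_range_mulOp (isClosed_sliceW hH) (shift_mem_sliceW hH) hw
      refine exists_inner_of_eq_range_right hφ (eq_range_of_orthogonal _
        (range_mulTen_le isIsometricMultiplier_unitVec_zero hφ hH hmem) fun x hx =>
          h.mem_orthogonal hH (fun a ha b => ?_) fun a b hb => ?_)
      · rw [hz, Submodule.mem_bot] at ha
        rw [ha, ← tenRight_apply, map_zero, inner_zero_left]
      · obtain ⟨y, rfl⟩ := hr b hb
        have := hx (ten a y)
        rwa [mulTen_ten, mulOp_one] at this
  · by_cases hw : sliceW S = ⊥
    · obtain ⟨φ, hφ, hmem, hr⟩ :=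
        exists_eq_range_mulOp (isClosed_sliceZ hH) (shift_mem_sliceZ hH) hz
      refine exists_inner_of_eq_range_left hφ (eq_range_of_orthogonal _
        (range_mulTen_le hφ isIsometricMultiplier_unitVec_zero hH hmem) fun x hx =>
          h.mem_orthogonal hH (fun a ha b => ?_) fun a b hb => ?_)
      · obtain ⟨y, rfl⟩ := hr a ha
        have := hx (ten y b)
        rwa [mulTen_ten, mulOp_one] at this
      · rw [hw, Submodule.mem_bot] at hb
        rw [hb, ← tenLeft_apply, map_zero, inner_zero_left]
    · obtain ⟨f, hf⟩ := exists_generator hH h1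
      obtain ⟨v, hvS, hv0, hv⟩ := h.exists_orthogonal_orbit hH htop hz hw f.2
      exact absurd (congrArg Subtype.val (eq_zero_of_orthogonal_orbit hH (v := ⟨v, hvS⟩) hf hv)) hv0

theorem rank_eq_one_of_eq_mulRange (hS : IsHardySubmodule S) {Θ : ℂ → ℂ → ℂ}
    (hΘ : IsOneVariableInner Θ) (h : (S : Set H2) = mulRange Θ) : hS.rank = 1 := by
  obtain ⟨φ, hφ, hcase⟩ := hΘ
  obtain ⟨a, ha, haφ⟩ := hφ.exists_isIsometricMultiplier
  rcases hcase with hcase | hcase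
  · refine rank_eq_one_of_eq_range hS _ (mulTen_monoMul ha isIsometricMultiplier_unitVec_zero) ?_
    rw [h, mulRange_eq_range_mulTen ha isIsometricMultiplier_unitVec_zero]
    intro z w hz hw
    rw [hcase z w hz hw, inner_szego_one, mul_one, haφ z hz]
  · refine rank_eq_one_of_eq_range hS _ (mulTen_monoMul isIsometricMultiplier_unitVec_zero ha) ?_
    rw [h, mulRange_eq_range_mulTen isIsometricMultiplier_unitVec_zero ha]
    intro z w hz hw
    rw [hcase z w hz hw, inner_szego_one, one_mul, haφ w hw]

end Rank

end HardyBidisc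

end

theorem mainTheorem2 (S : Submodule ℂ HardyBidisc.H2)
    (hS : HardyBidisc.IsCoDoublyCommuting S) :
    hS.toIsHardySubmodule.rank = 1 ↔
      ∃ Θ : ℂ → ℂ → ℂ, HardyBidisc.IsOneVariableInner Θ ∧
        (S : Set HardyBidisc.H2) = HardyBidisc.mulRange Θ :=
  ⟨HardyBidisc.exists_inner_of_rank_eq_one hS, fun ⟨_, hΘ, h⟩ =>
    HardyBidisc.rank_eq_one_of_eq_mulRange hS.toIsHardySubmodule hΘ h⟩
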